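/- Let $(M,g,J)$ be a Kähler surface, i.e. a complex surface (a complex manifold of complex dimension $2$) with a smooth Hermitian metric $g$ whose Kähler form $\omega(X,Y)=g(JX,Y)$ is closed, oriented by its complex structure. Let $s$ be the scalar curvature, $\mathcal R:\Lambda^2\to\Lambda^2$ the curvature operator (normalized to be the identity on the unit round sphere), $W$ the Weyl tensor acting on $\Lambda^2$ in the same way, $\Lambda^2_+$ the bundle of self-dual two-forms, and $\mathcal R_+^+,\,W_+:\Lambda^2_+\to\Lambda^2_+$ the blocks obtained by restricting $\mathcal R$, $W$ to $\Lambda^2_+$ and projecting orthogonally onto $\Lambda^2_+$; extend them complex linearly to $\Lambda^2_+\otimes\mathbb C$. Then $(M,g)$ is scalar-flat ($s\equiv 0$) if and only if it is anti-self-dual ($W_+\equiv 0$). Moreover, at every point of $M$: 1. there is an orthogonal direct sum decomposition $\Lambda^2_+\otimes\mathbb C=\mathbb C\,\omega\oplus\Lambda^{2,0}\oplus\Lambda^{0,2}$; 2. $\mathcal R_+^+$ is $\tfrac s4$ times the projection onto $\mathbb C\,\omega$, i.e. $\mathcal R_+^+\omega=\tfrac s4\,\omega$ and $\mathcal R_+^+=0$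 on $\Lambda^{2,0}\oplus\Lambda^{0,2}$; 3. $W_+$ is $\tfrac s{12}$ times the endomorphism with eigenvalues $2,-1,-1$, i.e. $W_+\omega=\tfrac s6\,\omega$ and $W_+=-\tfrac s{12}\,\mathrm{Id}$ on $\Lambda^{2,0}\oplus\Lambda^{0,2}$; 4. $|W_+|^2=\tfrac{s^2}{24}$, where $|W_+|^2$ is the squared Hilbert–Schmidt norm of the endomorphism $W_+$ of $\Lambda^2_+$. -/

import Mathlib

set_option maxSynthPendingDepth 3

open Module
open scoped Manifold ContDiff

/-! ### Linear algebra on an oriented Euclidean vector space -/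

noncomputable section

namespace KaehlerSurface

section Algebra


/-- Real-bilinear maps `V × V → K`, where `K` is `ℝ` or `ℂ`. -/
abbrev Bil (V : Type*) [AddCommGroup V] [Module ℝ V] (K : Type*) [Field K] [Algebra ℝ K] :=
  V →ₗ[ℝ] V →ₗ[ℝ] K

/-- Covariant tensors of rank four, `T X Y Z W = T(X, Y, Z, W)`. -/
abbrev Tensor4 (V : Type*) [AddCommGroup V] [Module ℝ V] :=
  V →ₗ[ℝ] V →ₗ[ℝ] Bil V ℝ

/-- The space `Λ²` of alternating two-forms with values in `K`. For `K = ℂ` this is the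
complexification `Λ² ⊗ ℂ` of the space of real two-forms. -/
def twoForms (V : Type*) [AddCommGroup V] [Module ℝ V] (K : Type*) [Field K] [Algebra ℝ K] :
    Submodule K (Bil V K) where
  carrier := {β | β.IsAlt}
  add_mem' := by
    intro a b ha hb v
    simp [ha v, hb v]
  zero_mem' := by
    intro v
    simp
  smul_mem' := by
    intro c a ha v
    simp [ha v]

/-- The tensor product `f ⊗ h` of two covectors, `(Z, W) ↦ f(Z) h(W)`. -/
def covTensor {V : Type*} [AddCommGroup V] [Module ℝ V] (f h : V →ₗ[ℝ] ℝ) : Bil V ℝ :=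
  LinearMap.mk₂ ℝ (fun z w => f z * h w)
    (by intros; simp only [map_add]; ring) (by intros; simp only [map_smul, smul_eq_mul]; ring)
    (by intros; simp only [map_add]; ring) (by intros; simp only [map_smul, smul_eq_mul]; ring)

@[simp] lemma covTensor_apply {V : Type*} [AddCommGroup V] [Module ℝ V] (f h : V →ₗ[ℝ] ℝ) (z w : V) :
    covTensor f h z w = f z * h w := rfl

/-- The Kulkarni–Nomizu product of two bilinear forms,
`A(X,Z)B(Y,W) - A(Y,Z)B(X,W) + B(X,Z)A(Y,W) - B(Y,Z)A(X,W)`. -/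
def kulkarniNomizu {V : Type*} [AddCommGroup V] [Module ℝ V] (A B : Bil V ℝ) : Tensor4 V :=
  LinearMap.mk₂ ℝ
    (fun x y => covTensor (A x) (B y) - covTensor (A y) (B x)
      + covTensor (B x) (A y) - covTensor (B y) (A x))
    (by intros; ext; simp; ring) (by intros; ext; simp; ring)
    (by intros; ext; simp; ring) (by intros; ext; simp; ring)

/-- The Riemann tensor of type `(0,4)` of a curvature endomorphism `R(X,Y)`, with the sign
convention `Rm(X, Y, Z, W) = ⟨R(X,Y)W, Z⟩`, for which the unit sphere has
`Rm(X, Y, Z, W) = ⟨X,Z⟩⟨Y,W⟩ - ⟨X,W⟩⟨Y,Z⟩`. -/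
def lowerIndex {V : Type*} [NormedAddCommGroup V] [InnerProductSpace ℝ V]
    (R : V →ₗ[ℝ] V →ₗ[ℝ] V →ₗ[ℝ] V) : Tensor4 V :=
  LinearMap.mk₂ ℝ (fun x y => (innerₗ V).compl₂ (R x y))
    (by intros; ext; simp [inner_add_right]) (by intros; ext; simp)
    (by intros; ext; simp [inner_add_right]) (by intros; ext; simp)

/-- An orthonormal basis of `V`, used to write down metric contractions; none of the contractions
below depends on the choice of the basis. -/
abbrev frame (V : Type*) [NormedAddCommGroup V] [InnerProductSpace ℝ V]
    [FiniteDimensional ℝ V] : OrthonormalBasis (Fin (finrank ℝ V)) ℝ V :=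
  stdOrthonormalBasis ℝ V

variable {V : Type*} [NormedAddCommGroup V] [InnerProductSpace ℝ V] [FiniteDimensional ℝ V]
variable {K : Type*} [Field K] [Algebra ℝ K]

/-- The Ricci contraction `Ric(Y, W) = ∑ i, T(e_i, Y, e_i, W)`. -/
def ricci (T : Tensor4 V) : Bil V ℝ :=
  LinearMap.mk₂ ℝ (fun y w => ∑ i, T (frame V i) y (frame V i) w)
    (by intros; simp [Finset.sum_add_distrib]) (by intros; simp [Finset.mul_sum])
    (by intros; simp [Finset.sum_add_distrib]) (by intros; simp [Finset.mul_sum])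

/-- The scalar curvature, the trace of the Ricci contraction. -/
def scalar (T : Tensor4 V) : ℝ := ∑ i, ricci T (frame V i) (frame V i)

/-- The trace-free Ricci tensor `Ric - (s/n) g`. -/
def ricciTraceFree (T : Tensor4 V) : Bil V ℝ :=
  ricci T - (scalar T / (finrank ℝ V : ℝ)) • innerₗ V

/-- The Weyl tensor `W = Rm - s/(2n(n-1)) g ∧ g - 1/(n-2) Ric₀ ∧ g`, where `∧` is the
Kulkarni–Nomizu product and `n = dim V ≥ 3`. -/
def weyl (T : Tensor4 V) : Tensor4 V :=
  T - (scalar T / (2 * (finrank ℝ V : ℝ) * ((finrank ℝ V : ℝ) - 1))) •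
        kulkarniNomizu (innerₗ V) (innerₗ V)
    - (1 / ((finrank ℝ V : ℝ) - 2)) • kulkarniNomizu (ricciTraceFree T) (innerₗ V)

/-- A tensor of rank four as an operator on two-forms,
`(T β)(X, Y) = ∑_{i<j} T(X, Y, e_i, e_j) β(e_i, e_j)`
(written as half of the sum over all pairs). For `K = ℂ` it is the `ℂ`-linear extension of the
operator on real forms. -/
def toOperator (K : Type*) [Field K] [Algebra ℝ K] (T : Tensor4 V) : Bil V K →ₗ[K] Bil V K where
  toFun β := (1 / 2 : K) • LinearMap.mk₂ ℝ
    (fun x y => ∑ i, ∑ j, T x y (frame V i) (frame V j) • β (frame V i) (frame V j))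
    (by intros; simp [Finset.sum_add_distrib, add_smul])
    (by intros; simp [Finset.smul_sum, mul_smul])
    (by intros; simp [Finset.sum_add_distrib, add_smul])
    (by intros; simp [Finset.smul_sum, mul_smul])
  map_add' := by
    intro a b
    ext x y
    simp [Finset.sum_add_distrib, mul_add]
  map_smul' := by
    intro c a
    ext x y
    simp only [LinearMap.smul_apply, LinearMap.mk₂_apply, RingHom.id_apply, smul_eq_mul,
      Finset.mul_sum]
    refine Finset.sum_congr rfl fun i _ => Finset.sum_congr rfl fun j _ => ?_
    simp only [Algebra.smul_def]
    ring

/-- The inner product of two-forms,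
`⟨α, β⟩ = ∑_{i<j} α(e_i, e_j) conj β(e_i, e_j)` (Hermitian for `K = ℂ`). -/
def formInner [StarRing K] (α β : Bil V K) : K :=
  (1 / 2 : K) * ∑ i, ∑ j,
    α (frame V i) (frame V j) * starRingEnd K (β (frame V i) (frame V j))

/-- The two-form `u♭ ∧ v♭`. -/
def wedge (u v : V) : Bil V ℝ :=
  covTensor (innerₗ V u) (innerₗ V v) - covTensor (innerₗ V v) (innerₗ V u)

/-- The squared norm `|A|² = ∑_{i<j} |A(e_i ∧ e_j)|²` of an operator `A` on real two-forms
(the forms `e_i ∧ e_j`, `i < j`, are an orthonormal basis of `Λ²`). -/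
def operatorNormSq (A : Bil V ℝ →ₗ[ℝ] Bil V ℝ) : ℝ :=
  (1 / 2) * ∑ i, ∑ j,
    formInner (A (wedge (frame V i) (frame V j))) (A (wedge (frame V i) (frame V j)))

/-! #### Dimension four: Hodge star and self-dual parts -/

lemma update_vec4 {W : Type*} (x y z w t : W) :
    Function.update ![x, y, z, w] 0 t = ![t, y, z, w] ∧
    Function.update ![x, y, z, w] 1 t = ![x, t, z, w] ∧
    Function.update ![x, y, z, w] 2 t = ![x, y, t, w] ∧
    Function.update ![x, y, z, w] 3 t = ![x, y, z, t] := by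
  refine ⟨?_, ?_, ?_, ?_⟩ <;> ext i <;> fin_cases i <;> rfl

/-- The Riemannian volume form of an oriented four-dimensional space as a tensor. -/
def volTensor [Fact (finrank ℝ V = 4)] (o : Orientation ℝ V (Fin 4)) : Tensor4 V :=
  LinearMap.mk₂ ℝ
    (fun x y => LinearMap.mk₂ ℝ (fun z w => o.volumeForm ![x, y, z, w])
      (fun z z' w => by simpa only [update_vec4] using o.volumeForm.map_update_add ![x, y, z, w] 2 z z')
      (fun c z w => by simpa only [update_vec4] using o.volumeForm.map_update_smul ![x, y, z, w] 2 c z)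
      (fun z w w' => by simpa only [update_vec4] using o.volumeForm.map_update_add ![x, y, z, w] 3 w w')
      (fun c z w => by simpa only [update_vec4] using o.volumeForm.map_update_smul ![x, y, z, w] 3 c w))
    (fun x x' y => by
      ext z w; simpa only [update_vec4, LinearMap.mk₂_apply, LinearMap.add_apply,
        LinearMap.smul_apply] using o.volumeForm.map_update_add ![x, y, z, w] 0 x x')
    (fun c x y => by
      ext z w; simpa only [update_vec4, LinearMap.mk₂_apply, LinearMap.add_apply,
        LinearMap.smul_apply] using o.volumeForm.map_update_smul ![x, y, z, w] 0 c x)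
    (fun x y y' => by
      ext z w; simpa only [update_vec4, LinearMap.mk₂_apply, LinearMap.add_apply,
        LinearMap.smul_apply] using o.volumeForm.map_update_add ![x, y, z, w] 1 y y')
    (fun c x y => by
      ext z w; simpa only [update_vec4, LinearMap.mk₂_apply, LinearMap.add_apply,
        LinearMap.smul_apply] using o.volumeForm.map_update_smul ![x, y, z, w] 1 c y)

/-- The Hodge star on two-forms, `(⋆β)(X, Y) = ∑_{i<j} vol(e_i, e_j, X, Y) β(e_i, e_j)`. -/
def hodgeStar (K : Type*) [Field K] [Algebra ℝ K] [Fact (finrank ℝ V = 4)]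
    (o : Orientation ℝ V (Fin 4)) : Bil V K →ₗ[K] Bil V K :=
  toOperator K (volTensor o)

/-- The space `Λ²₊` of self-dual two-forms; for `K = ℂ` this is `Λ²₊ ⊗ ℂ`. -/
def selfDualForms (K : Type*) [Field K] [Algebra ℝ K] [Fact (finrank ℝ V = 4)]
    (o : Orientation ℝ V (Fin 4)) : Submodule K (Bil V K) where
  carrier := {β | β ∈ twoForms V K ∧ hodgeStar K o β = β}
  add_mem' := by
    rintro a b ⟨ha, ha'⟩ ⟨hb, hb'⟩
    exact ⟨add_mem ha hb, by rw [map_add, ha', hb']⟩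
  zero_mem' := ⟨zero_mem _, map_zero _⟩
  smul_mem' := by
    rintro c a ⟨ha, ha'⟩
    exact ⟨Submodule.smul_mem _ c ha, by rw [map_smul, ha']⟩

/-- The projection `(1 + ⋆)/2` of `Λ²` onto `Λ²₊` along `Λ²₋`. -/
def projPlus (K : Type*) [Field K] [Algebra ℝ K] [Fact (finrank ℝ V = 4)]
    (o : Orientation ℝ V (Fin 4)) : Bil V K →ₗ[K] Bil V K :=
  (1 / 2 : K) • (LinearMap.id + hodgeStar K o)

/-- The block `A₊⁺ : Λ²₊ → Λ²₊` of the operator on two-forms given by a tensor, extended by zero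
to `Λ²₋`. -/
def plusBlock (K : Type*) [Field K] [Algebra ℝ K] [Fact (finrank ℝ V = 4)]
    (o : Orientation ℝ V (Fin 4)) (T : Tensor4 V) : Bil V K →ₗ[K] Bil V K :=
  projPlus K o ∘ₗ toOperator K T ∘ₗ projPlus K o

/-! #### Complex structures -/

/-- The fundamental form `ω(X, Y) = ⟨JX, Y⟩`, as a form with values in `K`. -/
def fundamentalForm (K : Type*) [Field K] [Algebra ℝ K] (J : V →ₗ[ℝ] V) : Bil V K :=
  ((innerₗ V).comp J).compr₂ (Algebra.linearMap ℝ K)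

/-- Complex two-forms with `α(JX, Y) = c α(X, Y)`. -/
def formsOfWeight {V : Type*} [AddCommGroup V] [Module ℝ V] (J : V →ₗ[ℝ] V) (c : ℂ) :
    Submodule ℂ (Bil V ℂ) where
  carrier := {α | α ∈ twoForms V ℂ ∧ ∀ x y, α (J x) y = c * α x y}
  add_mem' := by
    rintro a b ⟨ha, ha'⟩ ⟨hb, hb'⟩
    exact ⟨add_mem ha hb, fun x y => by simp [ha', hb', mul_add]⟩
  zero_mem' := ⟨zero_mem _, by simp⟩
  smul_mem' := by
    rintro d a ⟨ha, ha'⟩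
    exact ⟨Submodule.smul_mem _ d ha, fun x y => by simp [ha', mul_left_comm]⟩

/-- The space `Λ^{2,0}` of two-forms that are complex linear with respect to `J`. -/
def forms20 {V : Type*} [AddCommGroup V] [Module ℝ V] (J : V →ₗ[ℝ] V) : Submodule ℂ (Bil V ℂ) :=
  formsOfWeight J Complex.I

/-- The space `Λ^{0,2}` of two-forms that are complex antilinear with respect to `J`. -/
def forms02 {V : Type*} [AddCommGroup V] [Module ℝ V] (J : V →ₗ[ℝ] V) : Submodule ℂ (Bil V ℂ) :=
  formsOfWeight J (-Complex.I)

end Algebra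

/-! ### Riemannian geometry in coordinates -/

section Local

variable {E : Type*} [NormedAddCommGroup E] [NormedSpace ℝ E]

/-- The map `(u, v, w) ↦ ½ (∂_u g(v, w) + ∂_v g(u, w) - ∂_w g(u, v))` for a metric
`g` (Christoffel symbols of the first kind). -/
def christoffelLower (g : E → E →L[ℝ] E →L[ℝ] ℝ) (y : E) : E →L[ℝ] E →L[ℝ] E →L[ℝ] ℝ :=
  letI D : E →L[ℝ] E →L[ℝ] E →L[ℝ] ℝ := fderiv ℝ g y
  (1 / 2 : ℝ) • (D + D.flip -
    (ContinuousLinearMap.flipₗᵢ ℝ E E ℝ).toContinuousLinearEquiv.toContinuousLinearMap ∘L D.flip)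

lemma christoffelLower_apply (g : E → E →L[ℝ] E →L[ℝ] ℝ) (y u v w : E) :
    christoffelLower g y u v w = (1 / 2) * (fderiv ℝ g y u v w
      + fderiv ℝ g y v u w - fderiv ℝ g y w u v) := rfl

/-- The Christoffel symbols `Γ(u, v)` of the Levi-Civita connection of `g`, so that
`g(Γ(u, v), w) = ½ (∂_u g(v, w) + ∂_v g(u, w) - ∂_w g(u, v))`. -/
def christoffel (g : E → E →L[ℝ] E →L[ℝ] ℝ) (y : E) : E →L[ℝ] E →L[ℝ] E :=
  (ContinuousLinearMap.compL ℝ E (E →L[ℝ] ℝ) E (g y).inverse) ∘L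
    christoffelLower g y

lemma christoffel_apply (g : E → E →L[ℝ] E →L[ℝ] ℝ) (y u v : E) :
    christoffel g y u v = (g y).inverse (christoffelLower g y u v) := rfl

/-- The curvature of the Levi-Civita connection of `g`,
`R(u, v)w = (∂_u Γ)(v, w) - (∂_v Γ)(u, w) + Γ(u, Γ(v, w)) - Γ(v, Γ(u, w))`. -/
def localCurvature (g : E → E →L[ℝ] E →L[ℝ] ℝ) (y : E) : E →ₗ[ℝ] E →ₗ[ℝ] E →ₗ[ℝ] E :=
  letI Γ := christoffel g y
  letI D : E →L[ℝ] E →L[ℝ] E →L[ℝ] E := fderiv ℝ (christoffel g) y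
  LinearMap.mk₂ ℝ (fun u v => ((D u v - D v u + Γ u ∘L Γ v - Γ v ∘L Γ u : E →L[ℝ] E) :
      E →ₗ[ℝ] E))
    (by intros; ext1 w; simp; abel) (by intros; ext1 w; simp; module)
    (by intros; ext1 w; simp; abel) (by intros; ext1 w; simp; module)

/-- The exterior derivative of a two-form `η` on a vector space,
`dη(u, v, w) = ∂_u η(v, w) + ∂_v η(w, u) + ∂_w η(u, v)`. -/
def dTwoForm (η : E → E →L[ℝ] E →L[ℝ] ℝ) (y u v w : E) : ℝ :=
  fderiv ℝ η y u v w + fderiv ℝ η y v w u + fderiv ℝ η y w u v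

end Local

/-! ### Kähler surfaces -/

/-- The model space `ℂ²` of complex surfaces. -/
abbrev C2 : Type := EuclideanSpace ℂ (Fin 2)

/-- The real basis `(ε₁, iε₁, ε₂, iε₂)` of `ℂ²`, where `(ε₁, ε₂)` is the standard complex basis. -/
def realBasis : Basis (Fin 4) ℝ C2 :=
  (Complex.basisOneI.smulTower (EuclideanSpace.basisFun (Fin 2) ℂ).toBasis).reindex
    ((Equiv.prodComm (Fin 2) (Fin 2)).trans finProdFinEquiv)

lemma realBasis_eq : ⇑realBasis = ![EuclideanSpace.single 0 1, EuclideanSpace.single 0 Complex.I,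
    EuclideanSpace.single 1 1, EuclideanSpace.single 1 Complex.I] := by
  have h : ∀ i, realBasis i = Complex.basisOneI ((finProdFinEquiv (m := 2) (n := 2)).symm i).2 •
      (EuclideanSpace.single ((finProdFinEquiv (m := 2) (n := 2)).symm i).1 1 : C2) := by
    intro i
    simp [realBasis]
  funext i
  rw [h]
  fin_cases i <;> ext j <;> fin_cases j <;> simp [finProdFinEquiv, Fin.divNat, Fin.modNat]

lemma finrank_C2 : finrank ℝ C2 = 4 := by
  simpa using Module.finrank_eq_card_basis realBasis

section Manifold

open Bundle

variable (M : Type*) [TopologicalSpace M] [ChartedSpace C2 M]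

/-- A complex surface is in particular a smooth real manifold. -/
instance isManifold_real [IsManifold 𝓘(ℂ, C2) ω M] : IsManifold 𝓘(ℝ, C2) ∞ M := by
  refine isManifold_of_contDiffOn _ _ _ fun e e' he he' => ?_
  have h := (contDiffGroupoid ω 𝓘(ℂ, C2)).compatible he he'
  rw [contDiffGroupoid, mem_groupoid_of_pregroupoid] at h
  exact (h.1.restrict_scalars ℝ).of_le le_top

variable {M}

/-- The real tangent space at `x`; as a vector space it is `ℂ²`, through the derivative at `x` of
the preferred chart at `x`. -/
abbrev TS (x : M) : Type := TangentSpace 𝓘(ℝ, C2) x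

instance (x : M) : FiniteDimensional ℝ (TS x) := inferInstanceAs (FiniteDimensional ℝ C2)

instance (x : M) : Fact (finrank ℝ (TS x) = 4) := ⟨finrank_C2⟩

/-- The complex structure of the tangent spaces, multiplication by `i`. -/
def J (x : M) : TS x →ₗ[ℝ] TS x :=
  (LinearMap.lsmul ℂ C2 Complex.I).restrictScalars ℝ

/-- The orientation of the tangent spaces given by the complex structure. -/
def orient (x : M) : Orientation ℝ (TS x) (Fin 4) := realBasis.orientation

variable [RiemannianBundle (fun x : M => TangentSpace 𝓘(ℝ, C2) x)]

/-- The derivative at `y` of the inverse of the preferred chart at `x₀`. -/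
def dChartInv (x₀ : M) (y : C2) : C2 →L[ℝ] TS ((chartAt C2 x₀).symm y) :=
  mfderiv 𝓘(ℝ, C2) 𝓘(ℝ, C2) (chartAt C2 x₀).symm y

/-- The metric in the preferred chart at `x₀`: the pullback of `g` by the inverse of the chart. -/
def localMetric (x₀ : M) (y : C2) : C2 →L[ℝ] C2 →L[ℝ] ℝ :=
  (innerSL ℝ).bilinearComp (dChartInv x₀ y) (dChartInv x₀ y)

/-- The Riemann curvature `R(X, Y)Z` at `x`, computed in the preferred chart at `x`; this is the
chart whose derivative identifies the tangent space at `x` with `ℂ²`. -/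
def curvature (x : M) : TS x →ₗ[ℝ] TS x →ₗ[ℝ] TS x →ₗ[ℝ] TS x :=
  localCurvature (localMetric x) (chartAt C2 x x)

/-- The Riemann curvature tensor of type `(0,4)` at `x`. -/
def riemann (x : M) : Tensor4 (TS x) := lowerIndex (curvature x)

/-- The scalar curvature at `x`. -/
def scalarCurvature (x : M) : ℝ := scalar (riemann x)

/-- The operator `R₊⁺` on two-forms at `x`, the block of the curvature operator on `Λ²₊`. -/
def curvaturePlus (K : Type*) [Field K] [Algebra ℝ K] (x : M) : Bil (TS x) K →ₗ[K] Bil (TS x) K :=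
  plusBlock K (orient x) (riemann x)

/-- The self-dual Weyl curvature `W₊` at `x`, the block of the Weyl tensor on `Λ²₊`. -/
def weylPlus (K : Type*) [Field K] [Algebra ℝ K] (x : M) : Bil (TS x) K →ₗ[K] Bil (TS x) K :=
  plusBlock K (orient x) (weyl (riemann x))

/-- The Kähler form `ω(u, v) = g(Ju, v)` in the preferred chart at `x₀`. -/
def localKaehlerForm (x₀ : M) (y : C2) : C2 →L[ℝ] C2 →L[ℝ] ℝ :=
  (innerSL ℝ).bilinearComp
    ((LinearMap.toContinuousLinearMap (J ((chartAt C2 x₀).symm y))) ∘L dChartInv x₀ y)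
    (dChartInv x₀ y)

variable (M)

/-- The metric of a complex surface is Kähler if it is Hermitian (`J` is orthogonal) and its
Kähler form is closed, that is, `dω = 0` in every preferred chart. -/
structure IsKaehler : Prop where
  hermitian : ∀ (x : M) (u v : TS x), inner ℝ (J x u) (J x v) = inner ℝ u v
  closed : ∀ (x₀ : M), ∀ y ∈ (chartAt C2 x₀).target, ∀ u v w : C2,
    dTwoForm (localKaehlerForm x₀) y u v w = 0

/-- The scalar curvature vanishes everywhere. -/
def IsScalarFlat : Prop := ∀ x : M, scalarCurvature x = 0

/-- The self-dual Weyl curvature `W₊ : Λ²₊ → Λ²₊` vanishes everywhere, for the orientation given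
by the complex structure. -/
def IsAntiSelfDual : Prop :=
  ∀ x : M, ∀ β ∈ selfDualForms ℝ (orient x), weylPlus ℝ x β = 0

end Manifold

end KaehlerSurface

end

open KaehlerSurface Bundle

/-!
On an oriented four-dimensional Euclidean space with an orthogonal complex structure `J`, the
self-dual two-forms are spanned by the fundamental form `ω` and the `J`-anti-invariant forms, and
the complexification of the latter is `Λ^{2,0} ⊕ Λ^{0,2}` (`selfDualForms_eq_sup`). All of this is
read off from the components in a positively oriented orthonormal basis `(e, Je, f, Jf)`.

The curvature tensor of a Kähler metric satisfies `R(X, Y, JZ, JW) = R(X, Y, Z, W)` besides the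
usual symmetries (`IsKaehlerTensor`). Hence the curvature operator kills the anti-invariant forms
and, being symmetric, takes values in the invariant ones, so that `R₊⁺` is a multiple of the
projection onto the line of `ω`; the Bianchi identity identifies the factor as `s/4`
(`plusBlock_of_isKaehlerTensor`). In the decomposition of the curvature, the Kulkarni–Nomizu product
of the trace-free Ricci tensor with the metric exchanges `Λ²₊` and `Λ²₋`, and `g ∧ g` acts as
multiplication by two, so that `W₊ = R₊⁺ - s/12` (`plusBlock_weyl`). The eigenvalues, the norm of
`W₊` and the equivalence of `s = 0` with `W₊ = 0` follow.

The symmetries of the curvature are proved in a chart, where `J` is constant. The Koszul formula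
expresses `∇J` through `dω`, so that `J` is parallel (`IsKaehlerOn.christoffel_J`), and
differentiating `Γ(u, Jv) = J Γ(u, v)` shows that the curvature endomorphisms commute with `J`.
The charts of a complex surface have complex-linear derivatives, so the local expression of a Kähler
metric is Kähler for the constant complex structure (`isKaehlerOn_localMetric`). The curvature at a
point is formed in the tangent space with the norm given by the metric; the local results are
carried there by `IsKaehlerOn.pullback`.
-/

namespace KaehlerSurface

section Algebra

variable {V : Type*} [NormedAddCommGroup V] [InnerProductSpace ℝ V]
variable {K : Type*} [Field K] [Algebra ℝ K]

/-! ### Contractions in an arbitrary orthonormal basis -/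

/-- The trace of a bilinear map does not depend on the orthonormal basis. -/
lemma sum_orthonormalBasis_eq {ι κ W : Type*} [Fintype ι] [Fintype κ] [AddCommGroup W] [Module ℝ W]
    (b : OrthonormalBasis ι ℝ V) (c : OrthonormalBasis κ ℝ V) (B : V →ₗ[ℝ] V →ₗ[ℝ] W) :
    ∑ i, B (b i) (b i) = ∑ j, B (c j) (c j) := by
  calc ∑ i, B (b i) (b i) = ∑ i, B (∑ j, inner ℝ (c j) (b i) • c j) (b i) := by
        simp only [c.sum_repr']
    _ = ∑ j, ∑ i, inner ℝ (c j) (b i) • B (c j) (b i) := by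
        rw [Finset.sum_comm]
        simp
    _ = ∑ j, B (c j) (∑ i, inner ℝ (b i) (c j) • b i) := by
        simp [real_inner_comm]
    _ = ∑ j, B (c j) (c j) := by simp only [b.sum_repr']

lemma sum_sum_mul_orthonormalBasis_eq {ι κ : Type*} [Fintype ι] [Fintype κ]
    (b : OrthonormalBasis ι ℝ V) (c : OrthonormalBasis κ ℝ V) (P Q : Bil V K) :
    ∑ i, ∑ j, P (b i) (b j) * Q (b i) (b j) = ∑ i, ∑ j, P (c i) (c j) * Q (c i) (c j) := by
  calc ∑ i, ∑ j, P (b i) (b j) * Q (b i) (b j)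
      = ∑ i, ∑ j, P (b i) (c j) * Q (b i) (c j) := by
        refine Finset.sum_congr rfl fun i _ => ?_
        simpa using sum_orthonormalBasis_eq b c
          (((LinearMap.mul ℝ K).comp (P (b i))).compl₂ (Q (b i)))
    _ = ∑ j, ∑ i, P (b i) (c j) * Q (b i) (c j) := Finset.sum_comm
    _ = ∑ j, ∑ i, P (c i) (c j) * Q (c i) (c j) := by
        refine Finset.sum_congr rfl fun j _ => ?_
        simpa using sum_orthonormalBasis_eq b c
          (((LinearMap.mul ℝ K).comp (P.flip (c j))).compl₂ (Q.flip (c j)))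
    _ = _ := Finset.sum_comm

variable [FiniteDimensional ℝ V] {ι : Type*} [Fintype ι]

lemma ricci_apply_orthonormalBasis (b : OrthonormalBasis ι ℝ V) (T : Tensor4 V) (y w : V) :
    ricci T y w = ∑ i, T (b i) y (b i) w := by
  exact sum_orthonormalBasis_eq (frame V) b
    (LinearMap.mk₂ ℝ (fun x z => T x y z w) (by simp) (by simp) (by simp) (by simp))

lemma scalar_orthonormalBasis (b : OrthonormalBasis ι ℝ V) (T : Tensor4 V) :
    scalar T = ∑ j, ∑ i, T (b i) (b j) (b i) (b j) := by
  rw [scalar, sum_orthonormalBasis_eq (frame V) b (ricci T)]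
  simp only [ricci_apply_orthonormalBasis b]

lemma toOperator_apply_orthonormalBasis (b : OrthonormalBasis ι ℝ V) (T : Tensor4 V) (β : Bil V K)
    (x y : V) :
    toOperator K T β x y =
      (1 / 2 : K) * ∑ i, ∑ j, algebraMap ℝ K (T x y (b i) (b j)) * β (b i) (b j) := by
  have := sum_sum_mul_orthonormalBasis_eq (frame V) b ((T x y).compr₂ (Algebra.linearMap ℝ K)) β
  simpa [toOperator, Algebra.smul_def] using Or.inl this

lemma formInner_complex_orthonormalBasis (b : OrthonormalBasis ι ℝ V) (α β : Bil V ℂ) :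
    formInner α β = (1 / 2 : ℂ) * ∑ i, ∑ j, α (b i) (b j) * starRingEnd ℂ (β (b i) (b j)) := by
  have := sum_sum_mul_orthonormalBasis_eq (frame V) b α
    (β.compr₂ (Complex.conjAe.toLinearMap))
  simpa [formInner] using this

lemma formInner_real_orthonormalBasis (b : OrthonormalBasis ι ℝ V) (α β : Bil V ℝ) :
    formInner α β = (1 / 2 : ℝ) * ∑ i, ∑ j, α (b i) (b j) * β (b i) (b j) := by
  simpa [formInner] using sum_sum_mul_orthonormalBasis_eq (frame V) b α β

/-- The map `(u, v) ↦ u♭ ∧ v♭` as a bilinear map. -/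
noncomputable def wedgeBilin (V : Type*) [NormedAddCommGroup V] [InnerProductSpace ℝ V] :
    V →ₗ[ℝ] V →ₗ[ℝ] Bil V ℝ :=
  LinearMap.mk₂ ℝ wedge
    (by intros; ext; simp [wedge]; ring)
    (by intros; ext; simp [wedge]; ring)
    (by intros; ext; simp [wedge]; ring)
    (by intros; ext; simp [wedge]; ring)

lemma sum_sum_sum_sum_comm {κ ι : Type*} [Fintype κ] [Fintype ι] (F : κ → κ → ι → ι → ℝ) :
    ∑ i, ∑ j, ∑ k, ∑ l, F i j k l = ∑ k, ∑ l, ∑ i, ∑ j, F i j k l := by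
  calc ∑ i, ∑ j, ∑ k, ∑ l, F i j k l = ∑ p : κ × κ, ∑ q : ι × ι, F p.1 p.2 q.1 q.2 := by
        simp only [Fintype.sum_prod_type]
    _ = ∑ q : ι × ι, ∑ p : κ × κ, F p.1 p.2 q.1 q.2 := Finset.sum_comm
    _ = _ := by simp only [Fintype.sum_prod_type]

lemma operatorNormSq_orthonormalBasis (b : OrthonormalBasis ι ℝ V) (A : Bil V ℝ →ₗ[ℝ] Bil V ℝ) :
    operatorNormSq A = (1 / 2) * ∑ i, ∑ j,
      (1 / 2) * ∑ k, ∑ l, A (wedge (b i) (b j)) (b k) (b l) ^ 2 := by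
  have h : ∀ k l, ∑ i, ∑ j, A (wedge (frame V i) (frame V j)) (b k) (b l) *
        A (wedge (frame V i) (frame V j)) (b k) (b l) =
      ∑ i, ∑ j, A (wedge (b i) (b j)) (b k) (b l) * A (wedge (b i) (b j)) (b k) (b l) := by
    intro k l
    let P : Bil V ℝ := (wedgeBilin V).compr₂
      ((LinearMap.applyₗ (b l)).comp ((LinearMap.applyₗ (b k)).comp A))
    exact sum_sum_mul_orthonormalBasis_eq (frame V) b P P
  simp only [operatorNormSq, formInner_real_orthonormalBasis b, ← Finset.mul_sum]
  rw [sum_sum_sum_sum_comm,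
    sum_sum_sum_sum_comm fun i j k l => A (wedge (b i) (b j)) (b k) (b l) ^ 2]
  simp only [h, sq]

end Algebra

section Algebra

/-! ### Two-forms and the Hodge star in dimension four -/

section TwoForms

variable {V : Type*} [AddCommGroup V] [Module ℝ V] {K : Type*} [Field K] [Algebra ℝ K]

lemma neg_apply_swap_of_mem_twoForms {β : Bil V K} (hβ : β ∈ twoForms V K) (x y : V) :
    β x y = -β y x := (LinearMap.IsAlt.neg (show β.IsAlt from hβ) y x).symm

lemma apply_self_of_mem_twoForms {β : Bil V K} (hβ : β ∈ twoForms V K) (x : V) :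
    β x x = 0 := hβ x

end TwoForms

variable {V : Type*} [NormedAddCommGroup V] [InnerProductSpace ℝ V]
variable {K : Type*} [Field K] [Algebra ℝ K]

variable (b : OrthonormalBasis (Fin 4) ℝ V)

/-- In dimension four an alternating form is determined by six of its components. -/
lemma twoForms_ext {α β : Bil V K} (hα : α ∈ twoForms V K) (hβ : β ∈ twoForms V K)
    (h01 : α (b 0) (b 1) = β (b 0) (b 1)) (h02 : α (b 0) (b 2) = β (b 0) (b 2))
    (h03 : α (b 0) (b 3) = β (b 0) (b 3)) (h12 : α (b 1) (b 2) = β (b 1) (b 2))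
    (h13 : α (b 1) (b 3) = β (b 1) (b 3)) (h23 : α (b 2) (b 3) = β (b 2) (b 3)) : α = β := by
  have hd : α - β ∈ twoForms V K := sub_mem hα hβ
  have key : ∀ i j : Fin 4, i < j → (α - β) (b i) (b j) = 0 := by
    intro i j hij
    fin_cases i <;> fin_cases j <;> simp at hij <;>
      simp [h01, h02, h03, h12, h13, h23]
  refine b.toBasis.ext fun i => b.toBasis.ext fun j => ?_
  rw [← sub_eq_zero]
  change (α - β) (b.toBasis i) (b.toBasis j) = 0
  simp only [OrthonormalBasis.coe_toBasis]
  rcases lt_trichotomy i j with h | rfl | h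
  · exact key i j h
  · exact apply_self_of_mem_twoForms hd _
  · rw [neg_apply_swap_of_mem_twoForms hd, key j i h, neg_zero]

section VolTensor

variable [Fact (finrank ℝ V = 4)] {o : Orientation ℝ V (Fin 4)}

lemma volTensor_apply (x y z w : V) : volTensor o x y z w = o.volumeForm ![x, y, z, w] := rfl

lemma volTensor_swap₁₂ (x y z w : V) : volTensor o x y z w = -volTensor o y x z w := by
  simp only [volTensor_apply]
  rw [← o.volumeForm.map_swap _ (show (0 : Fin 4) ≠ 1 by decide)]
  congr 1; ext i; fin_cases i <;> rfl

lemma volTensor_swap₂₃ (x y z w : V) : volTensor o x y z w = -volTensor o x z y w := by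
  simp only [volTensor_apply]
  rw [← o.volumeForm.map_swap _ (show (1 : Fin 4) ≠ 2 by decide)]
  congr 1; ext i; fin_cases i <;> rfl

lemma volTensor_swap₃₄ (x y z w : V) : volTensor o x y z w = -volTensor o x y w z := by
  simp only [volTensor_apply]
  rw [← o.volumeForm.map_swap _ (show (2 : Fin 4) ≠ 3 by decide)]
  congr 1; ext i; fin_cases i <;> rfl

lemma volTensor_self₂₃ (x y z : V) : volTensor o x y y z = 0 := by
  linarith [volTensor_swap₂₃ (o := o) x y y z]

lemma volTensor_self₁₃ (x y z : V) : volTensor o x y x z = 0 := by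
  rw [volTensor_swap₁₂, volTensor_self₂₃, neg_zero]

lemma volTensor_self₂₄ (x y z : V) : volTensor o x y z y = 0 := by
  rw [volTensor_swap₃₄, volTensor_self₂₃, neg_zero]

lemma volTensor_self₁₄ (x y z : V) : volTensor o x y z x = 0 := by
  rw [volTensor_swap₃₄, volTensor_self₁₃, neg_zero]

variable {b} in
lemma volTensor_basis (hb : b.toBasis.orientation = o) :
    volTensor o (b 0) (b 1) (b 2) (b 3) = 1 := by
  have h : ![b 0, b 1, b 2, b 3] = ⇑b.toBasis := by
    ext i; fin_cases i <;> simp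
  rw [volTensor_apply, o.volumeForm_robust b hb, h, Basis.det_self]

end VolTensor

variable [FiniteDimensional ℝ V]

lemma toOperator_apply_of_mem_twoForms {T : Tensor4 V} (hT : ∀ x y z w, T x y z w = -T x y w z)
    {β : Bil V K} (hβ : β ∈ twoForms V K) (x y : V) :
    toOperator K T β x y =
      algebraMap ℝ K (T x y (b 0) (b 1)) * β (b 0) (b 1) +
      algebraMap ℝ K (T x y (b 0) (b 2)) * β (b 0) (b 2) +
      algebraMap ℝ K (T x y (b 0) (b 3)) * β (b 0) (b 3) +
      algebraMap ℝ K (T x y (b 1) (b 2)) * β (b 1) (b 2) +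
      algebraMap ℝ K (T x y (b 1) (b 3)) * β (b 1) (b 3) +
      algebraMap ℝ K (T x y (b 2) (b 3)) * β (b 2) (b 3) := by
  have : CharZero K := charZero_of_injective_algebraMap (algebraMap ℝ K).injective
  rw [toOperator_apply_orthonormalBasis b]
  simp only [Fin.sum_univ_four, apply_self_of_mem_twoForms hβ]
  rw [hT x y (b 1) (b 0), hT x y (b 2) (b 0), hT x y (b 3) (b 0), hT x y (b 2) (b 1),
    hT x y (b 3) (b 1), hT x y (b 3) (b 2),
    neg_apply_swap_of_mem_twoForms hβ (b 1) (b 0), neg_apply_swap_of_mem_twoForms hβ (b 2) (b 0),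
    neg_apply_swap_of_mem_twoForms hβ (b 3) (b 0), neg_apply_swap_of_mem_twoForms hβ (b 2) (b 1),
    neg_apply_swap_of_mem_twoForms hβ (b 3) (b 1), neg_apply_swap_of_mem_twoForms hβ (b 3) (b 2)]
  simp only [map_neg]
  ring

lemma toOperator_mem_twoForms {T : Tensor4 V} (hT : ∀ x y z w, T x y z w = -T y x z w)
    (β : Bil V K) : toOperator K T β ∈ twoForms V K := by
  intro x
  have h : ∀ z w, T x x z w = 0 := fun z w => by linarith [hT x x z w]
  simp [toOperator, h]

variable {b} [Fact (finrank ℝ V = 4)] {o : Orientation ℝ V (Fin 4)}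

lemma hodgeStar_mem_twoForms (β : Bil V K) : hodgeStar K o β ∈ twoForms V K :=
  toOperator_mem_twoForms volTensor_swap₁₂ β

/-- The Hodge star in a positively oriented orthonormal basis. -/
lemma hodgeStar_components (hb : b.toBasis.orientation = o) {β : Bil V K}
    (hβ : β ∈ twoForms V K) :
    hodgeStar K o β (b 0) (b 1) = β (b 2) (b 3) ∧ hodgeStar K o β (b 0) (b 2) = -β (b 1) (b 3) ∧
    hodgeStar K o β (b 0) (b 3) = β (b 1) (b 2) ∧ hodgeStar K o β (b 1) (b 2) = β (b 0) (b 3) ∧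
    hodgeStar K o β (b 1) (b 3) = -β (b 0) (b 2) ∧ hodgeStar K o β (b 2) (b 3) = β (b 0) (b 1) := by
  have e0 := volTensor_basis hb
  have e1 : volTensor o (b 0) (b 2) (b 1) (b 3) = -1 := by rw [volTensor_swap₂₃, e0]
  have e2 : volTensor o (b 0) (b 3) (b 1) (b 2) = 1 := by
    rw [volTensor_swap₂₃, volTensor_swap₃₄, neg_neg, e0]
  have e3 : volTensor o (b 1) (b 2) (b 0) (b 3) = 1 := by
    rw [volTensor_swap₂₃, volTensor_swap₁₂, neg_neg, e0]
  have e4 : volTensor o (b 1) (b 3) (b 0) (b 2) = -1 := by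
    rw [volTensor_swap₂₃, volTensor_swap₁₂, neg_neg, volTensor_swap₃₄, e0]
  have e5 : volTensor o (b 2) (b 3) (b 0) (b 1) = 1 := by
    rw [volTensor_swap₂₃, volTensor_swap₁₂, neg_neg, volTensor_swap₃₄, volTensor_swap₂₃,
      neg_neg, e0]
  simp only [hodgeStar, toOperator_apply_of_mem_twoForms b volTensor_swap₃₄ hβ, volTensor_self₂₃,
    volTensor_self₁₃, volTensor_self₂₄, volTensor_self₁₄, e0, e1, e2, e3, e4, e5]
  simp

end Algebra

section Algebra

variable {V : Type*} [NormedAddCommGroup V] [InnerProductSpace ℝ V]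
variable {K : Type*} [Field K] [Algebra ℝ K]

/-! ### Kähler curvature tensors -/

/-- A complex structure that preserves the inner product. -/
structure IsOrthogonalComplexStructure (J : V →ₗ[ℝ] V) : Prop where
  map_map : ∀ x, J (J x) = -x
  inner_map_map : ∀ x y, inner ℝ (J x) (J y) = inner ℝ x y

/-- A positively oriented orthonormal basis of the form `(e, Je, f, Jf)`. -/
structure IsAdapted (J : V →ₗ[ℝ] V) (o : Orientation ℝ V (Fin 4))
    (b : OrthonormalBasis (Fin 4) ℝ V) : Prop where
  map_zero : J (b 0) = b 1
  map_two : J (b 2) = b 3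
  orientation_eq : b.toBasis.orientation = o

/-- The algebraic identities satisfied by the curvature tensor of a Kähler metric, in the sign
convention of `lowerIndex`. -/
structure IsKaehlerTensor (J : V →ₗ[ℝ] V) (T : Tensor4 V) : Prop where
  swap₁₂ : ∀ x y z w, T x y z w = -T y x z w
  swap₃₄ : ∀ x y z w, T x y z w = -T x y w z
  bianchi : ∀ x y z w, T x y z w + T y z x w + T z x y w = 0
  map_J : ∀ x y z w, T x y (J z) (J w) = T x y z w

namespace IsKaehlerTensor

variable {J : V →ₗ[ℝ] V} {T : Tensor4 V} (hT : IsKaehlerTensor J T)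
include hT

/-- Pair symmetry, a consequence of the skew-symmetries and the Bianchi identity. -/
lemma pair_symm (x y z w : V) : T x y z w = T z w x y := by
  linarith [hT.bianchi x y z w, hT.bianchi y z w x, hT.bianchi z w x y, hT.bianchi w x y z,
    hT.swap₁₂ x y z w, hT.swap₁₂ y z x w, hT.swap₁₂ z x y w, hT.swap₁₂ y z w x, hT.swap₁₂ z w y x,
    hT.swap₁₂ w y z x, hT.swap₁₂ z w x y, hT.swap₁₂ w x z y, hT.swap₁₂ x z w y, hT.swap₁₂ w x y z,
    hT.swap₁₂ x y w z, hT.swap₁₂ y w x z,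
    hT.swap₃₄ x y z w, hT.swap₃₄ y z x w, hT.swap₃₄ z x y w, hT.swap₃₄ y z w x, hT.swap₃₄ z w y x,
    hT.swap₃₄ w y z x, hT.swap₃₄ z w x y, hT.swap₃₄ w x z y, hT.swap₃₄ x z w y, hT.swap₃₄ w x y z,
    hT.swap₃₄ x y w z, hT.swap₃₄ y w x z]

end IsKaehlerTensor

lemma kulkarniNomizu_apply (A B : Bil V ℝ) (x y z w : V) :
    kulkarniNomizu A B x y z w =
      A x z * B y w - A y z * B x w + B x z * A y w - B y z * A x w := by
  simp only [kulkarniNomizu, LinearMap.mk₂_apply, LinearMap.sub_apply, LinearMap.add_apply,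
    covTensor_apply]

variable [FiniteDimensional ℝ V] [Fact (finrank ℝ V = 4)] {o : Orientation ℝ V (Fin 4)}
  {b : OrthonormalBasis (Fin 4) ℝ V} {J : V →ₗ[ℝ] V}

/-! ### Self-dual forms -/

lemma mem_selfDualForms_iff (hb : b.toBasis.orientation = o) {β : Bil V K} :
    β ∈ selfDualForms K o ↔ β ∈ twoForms V K ∧ β (b 2) (b 3) = β (b 0) (b 1) ∧
      β (b 1) (b 3) = -β (b 0) (b 2) ∧ β (b 1) (b 2) = β (b 0) (b 3) := by
  refine ⟨fun h => ?_, fun h => ?_⟩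
  · obtain ⟨h, h'⟩ : β ∈ twoForms V K ∧ hodgeStar K o β = β := h
    obtain ⟨h1, h2, h3, -, -, -⟩ := hodgeStar_components hb h
    rw [h'] at h1 h2 h3
    exact ⟨h, h1.symm, by rw [h2, neg_neg], h3.symm⟩
  · obtain ⟨h, h1, h2, h3⟩ := h
    refine ⟨h, ?_⟩
    obtain ⟨k1, k2, k3, k4, k5, k6⟩ := hodgeStar_components hb h
    exact twoForms_ext b (hodgeStar_mem_twoForms β) h (by rw [k1, h1]) (by rw [k2, h2, neg_neg])
      (by rw [k3, h3]) (by rw [k4, h3]) (by rw [k5, h2]) (by rw [k6, h1])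

section Adapted

variable (hJ : IsOrthogonalComplexStructure J) (hb : IsAdapted J o b)
include hJ hb

omit [Fact (finrank ℝ V = 4)] [FiniteDimensional ℝ V] in
lemma IsAdapted.map_one : J (b 1) = -b 0 := by rw [← hb.map_zero, hJ.map_map]

omit [Fact (finrank ℝ V = 4)] [FiniteDimensional ℝ V] in
lemma IsAdapted.map_three : J (b 3) = -b 2 := by rw [← hb.map_two, hJ.map_map]

omit [Fact (finrank ℝ V = 4)] [FiniteDimensional ℝ V] hb in
lemma fundamentalForm_mem_twoForms : fundamentalForm K J ∈ twoForms V K := by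
  intro x
  have h : inner ℝ (J x) x = 0 := by
    have := hJ.inner_map_map (J x) x
    rw [hJ.map_map, inner_neg_left, real_inner_comm] at this
    linarith
  simp [fundamentalForm, h]

omit [Fact (finrank ℝ V = 4)] [FiniteDimensional ℝ V] in
lemma fundamentalForm_components :
    fundamentalForm K J (b 0) (b 1) = 1 ∧ fundamentalForm K J (b 0) (b 2) = 0 ∧
    fundamentalForm K J (b 0) (b 3) = 0 ∧ fundamentalForm K J (b 1) (b 2) = 0 ∧
    fundamentalForm K J (b 1) (b 3) = 0 ∧ fundamentalForm K J (b 2) (b 3) = 1 := by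
  simp [fundamentalForm, hb.map_zero, hb.map_two, hb.map_one hJ,
    b.inner_eq_ite]

lemma fundamentalForm_mem_selfDualForms : fundamentalForm K J ∈ selfDualForms K o := by
  obtain ⟨h1, h2, h3, h4, h5, h6⟩ := fundamentalForm_components (K := K) hJ hb
  rw [mem_selfDualForms_iff hb.orientation_eq]
  exact ⟨fundamentalForm_mem_twoForms hJ, by rw [h6, h1], by rw [h5, h2, neg_zero],
    by rw [h4, h3]⟩

omit [Fact (finrank ℝ V = 4)] [FiniteDimensional ℝ V] in
/-- A `J`-anti-invariant two-form is self-dual and orthogonal to the fundamental form. -/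
lemma antiInvariant_components {α : Bil V K} (hα : α ∈ twoForms V K)
    (h : ∀ x y, α (J x) (J y) = -α x y) :
    α (b 0) (b 1) = 0 ∧ α (b 2) (b 3) = 0 ∧ α (b 1) (b 3) = -α (b 0) (b 2) ∧
      α (b 1) (b 2) = α (b 0) (b 3) := by
  have : CharZero K := charZero_of_injective_algebraMap (algebraMap ℝ K).injective
  have key : ∀ x, α x (J x) = 0 := by
    intro x
    have h1 := h x (J x)
    rw [hJ.map_map, map_neg, neg_inj, neg_apply_swap_of_mem_twoForms hα] at h1
    exact self_eq_neg.mp h1.symm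
  refine ⟨?_, ?_, ?_, ?_⟩
  · rw [← hb.map_zero, key]
  · rw [← hb.map_two, key]
  · rw [← hb.map_zero, ← hb.map_two, h]
  · have h1 := h (b 0) (b 3)
    rw [hb.map_three hJ, hb.map_zero, map_neg, neg_inj] at h1
    exact h1

lemma antiInvariant_mem_selfDualForms {α : Bil V K} (hα : α ∈ twoForms V K)
    (h : ∀ x y, α (J x) (J y) = -α x y) : α ∈ selfDualForms K o := by
  obtain ⟨h1, h2, h3, h4⟩ := antiInvariant_components hJ hb hα h
  exact (mem_selfDualForms_iff hb.orientation_eq).2 ⟨hα, by rw [h1, h2], h3, h4⟩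

end Adapted

/-! ### The self-dual blocks of the curvature and of the Weyl tensor -/

lemma projPlus_mem_twoForms {β : Bil V K} (hβ : β ∈ twoForms V K) :
    projPlus K o β ∈ twoForms V K :=
  Submodule.smul_mem _ _ (add_mem hβ (hodgeStar_mem_twoForms β))

lemma projPlus_apply_of_mem {β : Bil V K} (hβ : β ∈ selfDualForms K o) :
    projPlus K o β = β := by
  have : CharZero K := charZero_of_injective_algebraMap (algebraMap ℝ K).injective
  simp only [projPlus, LinearMap.smul_apply, LinearMap.add_apply, LinearMap.id_apply, hβ.2]
  rw [← two_smul K β, smul_smul]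
  norm_num

lemma projPlus_components (hb : b.toBasis.orientation = o) {β : Bil V K}
    (hβ : β ∈ twoForms V K) :
    projPlus K o β (b 0) (b 1) = (β (b 0) (b 1) + β (b 2) (b 3)) / 2 ∧
    projPlus K o β (b 0) (b 2) = (β (b 0) (b 2) - β (b 1) (b 3)) / 2 ∧
    projPlus K o β (b 0) (b 3) = (β (b 0) (b 3) + β (b 1) (b 2)) / 2 := by
  obtain ⟨k1, k2, k3, -, -, -⟩ := hodgeStar_components hb hβ
  simp only [projPlus, LinearMap.smul_apply, LinearMap.add_apply, LinearMap.id_apply, k1, k2, k3,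
    smul_eq_mul]
  refine ⟨?_, ?_, ?_⟩ <;> ring

lemma projPlus_mem_selfDualForms (hb : b.toBasis.orientation = o) {β : Bil V K}
    (hβ : β ∈ twoForms V K) : projPlus K o β ∈ selfDualForms K o := by
  rw [mem_selfDualForms_iff hb]
  obtain ⟨k1, k2, k3, k4, k5, k6⟩ := hodgeStar_components hb hβ
  refine ⟨projPlus_mem_twoForms hβ, ?_, ?_, ?_⟩ <;>
  simp only [projPlus, LinearMap.smul_apply, LinearMap.add_apply, LinearMap.id_apply, k1, k2, k3,
    smul_eq_mul, k4, k5, k6] <;> ring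

lemma selfDualForms_ext (hb : b.toBasis.orientation = o) {α β : Bil V K}
    (hα : α ∈ selfDualForms K o) (hβ : β ∈ selfDualForms K o)
    (h1 : α (b 0) (b 1) = β (b 0) (b 1)) (h2 : α (b 0) (b 2) = β (b 0) (b 2))
    (h3 : α (b 0) (b 3) = β (b 0) (b 3)) : α = β := by
  rw [mem_selfDualForms_iff hb] at hα hβ
  obtain ⟨hα, a1, a2, a3⟩ := hα
  obtain ⟨hβ, b1, b2, b3⟩ := hβ
  exact twoForms_ext b hα hβ h1 h2 h3 (by rw [a3, b3, h3]) (by rw [a2, b2, h2])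
    (by rw [a1, b1, h1])

lemma toOperator_apply_of_mem_selfDualForms (hb : b.toBasis.orientation = o)
    {T : Tensor4 V} (hT : ∀ x y z w, T x y z w = -T x y w z)
    {β : Bil V K} (hβ : β ∈ selfDualForms K o) (x y : V) :
    toOperator K T β x y =
      algebraMap ℝ K (T x y (b 0) (b 1) + T x y (b 2) (b 3)) * β (b 0) (b 1) +
      algebraMap ℝ K (T x y (b 0) (b 2) - T x y (b 1) (b 3)) * β (b 0) (b 2) +
      algebraMap ℝ K (T x y (b 0) (b 3) + T x y (b 1) (b 2)) * β (b 0) (b 3) := by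
  obtain ⟨hβ, a1, a2, a3⟩ := (mem_selfDualForms_iff hb).1 hβ
  rw [toOperator_apply_of_mem_twoForms b hT hβ, a1, a2, a3]
  simp only [map_add, map_sub]
  ring

lemma plusBlock_apply_of_mem {T : Tensor4 V} {β : Bil V K} (hβ : β ∈ selfDualForms K o) :
    plusBlock K o T β = projPlus K o (toOperator K T β) := by
  simp only [plusBlock, LinearMap.comp_apply, projPlus_apply_of_mem hβ]

/-- On self-dual forms the curvature operator of a Kähler metric is `s/4` times the projection to
the line spanned by the fundamental form: by `J`-invariance only the component along the
fundamental form contributes, and the Bianchi identity gives the factor. -/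
theorem plusBlock_of_isKaehlerTensor (hJ : IsOrthogonalComplexStructure J) (hb : IsAdapted J o b)
    {T : Tensor4 V} (hT : IsKaehlerTensor J T) {β : Bil V K} (hβ : β ∈ selfDualForms K o) :
    plusBlock K o T β =
      (algebraMap ℝ K (scalar T / 4) * β (b 0) (b 1)) • fundamentalForm K J := by
  have hm := toOperator_mem_twoForms (K := K) hT.swap₁₂ β
  have i1 : ∀ x y, T x y (b 1) (b 3) = T x y (b 0) (b 2) := fun x y => by
    rw [← hb.map_zero, ← hb.map_two, hT.map_J]
  have i2 : ∀ x y, T x y (b 1) (b 2) = -T x y (b 0) (b 3) := fun x y => by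
    have := hT.map_J x y (b 0) (b 3)
    rw [hb.map_zero, hb.map_three hJ, map_neg] at this
    linarith
  -- `J`-invariance and the Bianchi identity give `T(0,1,2,3) = T(0,2,0,2) + T(0,3,0,3)`
  have hs : scalar T = T (b 0) (b 1) (b 0) (b 1) + T (b 0) (b 1) (b 2) (b 3) +
      (T (b 2) (b 3) (b 0) (b 1) + T (b 2) (b 3) (b 2) (b 3)) +
      (T (b 0) (b 1) (b 0) (b 1) + T (b 0) (b 1) (b 2) (b 3) +
      (T (b 2) (b 3) (b 0) (b 1) + T (b 2) (b 3) (b 2) (b 3))) := by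
    rw [scalar_orthonormalBasis b]
    have z : ∀ x z w, T x x z w = 0 := fun x z w => by linarith [hT.swap₁₂ x x z w]
    have n : ∀ x y, T y x y x = T x y x y := fun x y => by
      rw [hT.swap₁₂, hT.swap₃₄, neg_neg]
    simp only [Fin.sum_univ_four, z, n (b 0) (b 1), n (b 0) (b 2), n (b 0) (b 3), n (b 1) (b 2),
      n (b 1) (b 3), n (b 2) (b 3)]
    have B := hT.bianchi (b 0) (b 1) (b 2) (b 3)
    have p := hT.pair_symm (b 0) (b 1) (b 2) (b 3)
    have q1 := i1 (b 1) (b 3)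
    have q2 := hT.pair_symm (b 1) (b 3) (b 0) (b 2)
    have q3 := i1 (b 0) (b 2)
    have q4 := i2 (b 1) (b 2)
    have q5 := hT.pair_symm (b 1) (b 2) (b 0) (b 3)
    have q6 := i2 (b 0) (b 3)
    have q7 := hT.swap₁₂ (b 2) (b 0) (b 1) (b 3)
    linarith
  obtain ⟨k1, k2, k3⟩ := projPlus_components hb.orientation_eq hm
  obtain ⟨w1, w2, w3, -, -, -⟩ := fundamentalForm_components (K := K) hJ hb
  have e := toOperator_apply_of_mem_selfDualForms hb.orientation_eq hT.swap₃₄ hβ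
  have hp : ∀ z w, T (b 1) (b 3) z w = T (b 0) (b 2) z w := fun z w => by
    rw [hT.pair_symm, i1, hT.pair_symm]
  have hq : ∀ z w, T (b 1) (b 2) z w = -T (b 0) (b 3) z w := fun z w => by
    rw [hT.pair_symm, i2, hT.pair_symm]
  rw [plusBlock_apply_of_mem hβ]
  refine selfDualForms_ext hb.orientation_eq (projPlus_mem_selfDualForms hb.orientation_eq hm)
    (Submodule.smul_mem _ _ (fundamentalForm_mem_selfDualForms hJ hb)) ?_ ?_ ?_
  · simp only [k1, e, LinearMap.smul_apply, smul_eq_mul, w1, i1, i2, sub_self, add_neg_cancel,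
      map_zero, zero_mul, add_zero, mul_one, ← add_mul, ← map_add]
    rw [mul_div_right_comm, ← map_ofNat (algebraMap ℝ K) 2, ← map_div₀, hs]
    congr 2
    ring
  · simp [k2, e, w2, i1, i2, hp]
  · simp only [k3, e, LinearMap.smul_apply, smul_eq_mul, w3, i1, i2, hq, map_add, map_neg,
      sub_self, map_zero]
    ring

end Algebra

section Algebra

variable {V : Type*} [NormedAddCommGroup V] [InnerProductSpace ℝ V]
variable {K : Type*} [Field K] [Algebra ℝ K]
variable [FiniteDimensional ℝ V]

lemma toOperator_sub_smul_sub_smul (T S U : Tensor4 V) (c d : ℝ) (β : Bil V K) :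
    toOperator K (T - c • S - d • U) β = toOperator K T β -
      algebraMap ℝ K c • toOperator K S β - algebraMap ℝ K d • toOperator K U β := by
  ext x y
  simp only [toOperator_apply_orthonormalBasis (frame V), LinearMap.sub_apply,
    LinearMap.smul_apply, smul_eq_mul, map_sub, map_mul, sub_mul, Finset.sum_sub_distrib,
    mul_sub, mul_assoc, ← Finset.mul_sum]
  simp only [mul_left_comm]

variable [Fact (finrank ℝ V = 4)] {o : Orientation ℝ V (Fin 4)}
  {b : OrthonormalBasis (Fin 4) ℝ V} {J : V →ₗ[ℝ] V}

omit [Fact (finrank ℝ V = 4)] in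
lemma toOperator_kulkarniNomizu_inner (b : OrthonormalBasis (Fin 4) ℝ V) {β : Bil V K}
    (hβ : β ∈ twoForms V K) :
    toOperator K (kulkarniNomizu (innerₗ V) (innerₗ V)) β = (2 : K) • β := by
  have hs : ∀ x y z w : V, kulkarniNomizu (innerₗ V) (innerₗ V) x y z w =
      -kulkarniNomizu (innerₗ V) (innerₗ V) y x z w := fun x y z w => by
    simp only [kulkarniNomizu_apply]; ring
  have hs' : ∀ x y z w : V, kulkarniNomizu (innerₗ V) (innerₗ V) x y z w =
      -kulkarniNomizu (innerₗ V) (innerₗ V) x y w z := fun x y z w => by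
    simp only [kulkarniNomizu_apply]; ring
  refine twoForms_ext b (toOperator_mem_twoForms hs β) (Submodule.smul_mem _ _ hβ)
    ?_ ?_ ?_ ?_ ?_ ?_ <;>
  · simp [toOperator_apply_of_mem_twoForms b hs' hβ, kulkarniNomizu_apply, b.inner_eq_ite]
    norm_num

/-- The Kulkarni–Nomizu product of a trace-free symmetric form with the metric maps self-dual
forms to anti-self-dual ones. -/
lemma projPlus_toOperator_kulkarniNomizu (hb : b.toBasis.orientation = o) {A : Bil V ℝ}
    (hA : ∀ x y, A x y = A y x) (htr : ∑ i, A (b i) (b i) = 0)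
    {β : Bil V K} (hβ : β ∈ selfDualForms K o) :
    projPlus K o (toOperator K (kulkarniNomizu A (innerₗ V)) β) = 0 := by
  have hs : ∀ x y z w : V, kulkarniNomizu A (innerₗ V) x y z w =
      -kulkarniNomizu A (innerₗ V) y x z w := fun x y z w => by
    simp only [kulkarniNomizu_apply]; ring
  have hs' : ∀ x y z w : V, kulkarniNomizu A (innerₗ V) x y z w =
      -kulkarniNomizu A (innerₗ V) x y w z := fun x y z w => by
    simp only [kulkarniNomizu_apply]; ring
  have hm := toOperator_mem_twoForms (K := K) hs β
  obtain ⟨k1, k2, k3⟩ := projPlus_components hb hm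
  rw [Fin.sum_univ_four] at htr
  have h33 : A (b 3) (b 3) = -(A (b 0) (b 0) + A (b 1) (b 1) + A (b 2) (b 2)) := by linarith
  refine selfDualForms_ext hb (projPlus_mem_selfDualForms hb hm) (zero_mem _) ?_ ?_ ?_
  · rw [k1]
    simp [toOperator_apply_of_mem_selfDualForms hb hs' hβ, kulkarniNomizu_apply, b.inner_eq_ite,
      hA (b 1) (b 0), hA (b 2) (b 0), hA (b 3) (b 0), hA (b 2) (b 1), hA (b 3) (b 1),
      hA (b 3) (b 2), h33]
    left; ring
  · rw [k2]
    simp [toOperator_apply_of_mem_selfDualForms hb hs' hβ, kulkarniNomizu_apply, b.inner_eq_ite,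
      hA (b 1) (b 0), hA (b 2) (b 0), hA (b 3) (b 0), hA (b 2) (b 1), hA (b 3) (b 1),
      hA (b 3) (b 2), h33]
    left; ring
  · rw [k3]
    simp [toOperator_apply_of_mem_selfDualForms hb hs' hβ, kulkarniNomizu_apply, b.inner_eq_ite,
      hA (b 1) (b 0), hA (b 2) (b 0), hA (b 3) (b 0), hA (b 2) (b 1), hA (b 3) (b 1),
      hA (b 3) (b 2), h33]
    left; ring

/-- On self-dual forms the curvature operator and the Weyl operator differ by `s/12`. -/
theorem plusBlock_weyl (hb : b.toBasis.orientation = o) {T : Tensor4 V}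
    (hT : IsKaehlerTensor J T) {β : Bil V K} (hβ : β ∈ selfDualForms K o) :
    plusBlock K o (weyl T) β = plusBlock K o T β - algebraMap ℝ K (scalar T / 12) • β := by
  have h4 : (finrank ℝ V : ℝ) = 4 := by exact_mod_cast (Fact.out : finrank ℝ V = 4)
  have hsym : ∀ x y, ricciTraceFree T x y = ricciTraceFree T y x := by
    intro x y
    have : ricci T x y = ricci T y x := by
      simp only [ricci_apply_orthonormalBasis b]
      exact Finset.sum_congr rfl fun i _ => hT.pair_symm _ _ _ _
    simp [ricciTraceFree, this, real_inner_comm]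
  have htr : ∑ i, ricciTraceFree T (b i) (b i) = 0 := by
    have : scalar T = ∑ i, ricci T (b i) (b i) := by
      simp only [scalar_orthonormalBasis b, ricci_apply_orthonormalBasis b]
    simp only [ricciTraceFree, LinearMap.sub_apply, LinearMap.smul_apply, innerₗ_apply_apply,
      Finset.sum_sub_distrib, ← this, b.inner_eq_ite, h4]
    simp
    ring
  rw [plusBlock_apply_of_mem hβ, plusBlock_apply_of_mem hβ, weyl, toOperator_sub_smul_sub_smul,
    map_sub, map_sub, map_smul, map_smul, projPlus_toOperator_kulkarniNomizu hb hsym htr hβ,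
    toOperator_kulkarniNomizu_inner b hβ.1, map_smul, projPlus_apply_of_mem hβ, smul_zero, sub_zero,
    smul_smul, ← map_ofNat (algebraMap ℝ K) 2, ← map_mul, h4]
  congr 3
  ring

/-! ### The pointwise statement -/

section Pointwise

variable (hJ : IsOrthogonalComplexStructure J) (hb : IsAdapted J o b)
include hJ hb

lemma plusBlock_fundamentalForm {T : Tensor4 V} (hT : IsKaehlerTensor J T) :
    plusBlock K o T (fundamentalForm K J) =
      algebraMap ℝ K (scalar T / 4) • fundamentalForm K J := by
  rw [plusBlock_of_isKaehlerTensor hJ hb hT (fundamentalForm_mem_selfDualForms hJ hb),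
    (fundamentalForm_components hJ hb).1, mul_one]

lemma plusBlock_antiInvariant {T : Tensor4 V} (hT : IsKaehlerTensor J T) {α : Bil V K}
    (hα : α ∈ twoForms V K) (h : ∀ x y, α (J x) (J y) = -α x y) :
    plusBlock K o T α = 0 := by
  rw [plusBlock_of_isKaehlerTensor hJ hb hT (antiInvariant_mem_selfDualForms hJ hb hα h),
    (antiInvariant_components hJ hb hα h).1, mul_zero, zero_smul]

lemma plusBlock_weyl_fundamentalForm {T : Tensor4 V} (hT : IsKaehlerTensor J T) :
    plusBlock K o (weyl T) (fundamentalForm K J) =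
      algebraMap ℝ K (scalar T / 6) • fundamentalForm K J := by
  rw [plusBlock_weyl hb.orientation_eq hT (fundamentalForm_mem_selfDualForms hJ hb),
    plusBlock_fundamentalForm hJ hb hT, ← sub_smul, ← map_sub]
  congr 2
  ring

lemma plusBlock_weyl_antiInvariant {T : Tensor4 V} (hT : IsKaehlerTensor J T) {α : Bil V K}
    (hα : α ∈ twoForms V K) (h : ∀ x y, α (J x) (J y) = -α x y) :
    plusBlock K o (weyl T) α = algebraMap ℝ K (-scalar T / 12) • α := by
  rw [plusBlock_weyl hb.orientation_eq hT (antiInvariant_mem_selfDualForms hJ hb hα h),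
    plusBlock_antiInvariant hJ hb hT hα h, zero_sub, ← neg_smul, ← map_neg, neg_div]

/-- The norm of `W₊ β`, in terms of the components of `β`. -/
lemma sum_plusBlock_weyl_sq {T : Tensor4 V} (hT : IsKaehlerTensor J T) {β : Bil V ℝ}
    (hβ : β ∈ twoForms V ℝ) :
    (1 / 2 : ℝ) * ∑ k, ∑ l, plusBlock ℝ o (weyl T) β (b k) (b l) ^ 2 =
      scalar T ^ 2 / 288 * (4 * (β (b 0) (b 1) + β (b 2) (b 3)) ^ 2 +
        (β (b 0) (b 2) - β (b 1) (b 3)) ^ 2 + (β (b 0) (b 3) + β (b 1) (b 2)) ^ 2) := by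
  have hp := projPlus_mem_selfDualForms hb.orientation_eq hβ
  have h1 : plusBlock ℝ o (weyl T) β = plusBlock ℝ o (weyl T) (projPlus ℝ o β) := by
    simp only [plusBlock, LinearMap.comp_apply, projPlus_apply_of_mem hp]
  obtain ⟨k1, k2, k3⟩ := projPlus_components hb.orientation_eq hβ
  obtain ⟨hp', a1, a2, a3⟩ := (mem_selfDualForms_iff hb.orientation_eq).1 hp
  obtain ⟨w1, w2, w3, w4, w5, w6⟩ := fundamentalForm_components (K := ℝ) hJ hb
  have hw := fundamentalForm_mem_twoForms (K := ℝ) hJ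
  rw [h1, plusBlock_weyl hb.orientation_eq hT hp, plusBlock_of_isKaehlerTensor hJ hb hT hp]
  simp only [Fin.sum_univ_four, LinearMap.sub_apply, LinearMap.smul_apply, smul_eq_mul,
    apply_self_of_mem_twoForms hp', apply_self_of_mem_twoForms hw,
    neg_apply_swap_of_mem_twoForms hp' (b 1) (b 0), neg_apply_swap_of_mem_twoForms hp' (b 2) (b 0),
    neg_apply_swap_of_mem_twoForms hp' (b 3) (b 0), neg_apply_swap_of_mem_twoForms hp' (b 2) (b 1),
    neg_apply_swap_of_mem_twoForms hp' (b 3) (b 1), neg_apply_swap_of_mem_twoForms hp' (b 3) (b 2),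
    neg_apply_swap_of_mem_twoForms hw (b 1) (b 0), neg_apply_swap_of_mem_twoForms hw (b 2) (b 0),
    neg_apply_swap_of_mem_twoForms hw (b 3) (b 0), neg_apply_swap_of_mem_twoForms hw (b 2) (b 1),
    neg_apply_swap_of_mem_twoForms hw (b 3) (b 1), neg_apply_swap_of_mem_twoForms hw (b 3) (b 2),
    a1, a2, a3, k1, k2, k3, w1, w2, w3, w4, w5, w6, Algebra.algebraMap_self, RingHom.id_apply]
  ring

theorem operatorNormSq_plusBlock_weyl {T : Tensor4 V} (hT : IsKaehlerTensor J T) :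
    operatorNormSq (plusBlock ℝ o (weyl T)) = scalar T ^ 2 / 24 := by
  have hw : ∀ u v : V, wedge u v ∈ twoForms V ℝ := fun u v x => by
    simp [wedge, mul_comm]
  rw [operatorNormSq_orthonormalBasis b]
  simp only [sum_plusBlock_weyl_sq hJ hb hT (hw _ _)]
  simp [Fin.sum_univ_four, wedge, b.inner_eq_ite]
  ring

theorem plusBlock_weyl_eq_zero_iff {T : Tensor4 V} (hT : IsKaehlerTensor J T) :
    (∀ β ∈ selfDualForms ℝ o, plusBlock ℝ o (weyl T) β = 0) ↔ scalar T = 0 := by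
  constructor
  · intro h
    have h1 := h _ (fundamentalForm_mem_selfDualForms hJ hb)
    rw [plusBlock_weyl_fundamentalForm hJ hb hT] at h1
    have h2 := congrArg (fun β : Bil V ℝ => β (b 0) (b 1)) h1
    simpa [(fundamentalForm_components (K := ℝ) hJ hb).1] using h2
  · intro h β hβ
    rw [plusBlock_weyl hb.orientation_eq hT hβ, plusBlock_of_isKaehlerTensor hJ hb hT hβ, h]
    simp

end Pointwise

end Algebra

section Algebra

/-! ### Decomposition of the complex self-dual forms -/

section Weights

variable {V : Type*} [AddCommGroup V] [Module ℝ V] {J : V →ₗ[ℝ] V}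

lemma map_map_eq_neg_of_mem_formsOfWeight {c : ℂ} (hc : c * c = -1) {α : Bil V ℂ}
    (hα : α ∈ formsOfWeight J c) (x y : V) : α (J x) (J y) = -α x y := by
  rw [hα.2, neg_apply_swap_of_mem_twoForms hα.1 x, hα.2, neg_apply_swap_of_mem_twoForms hα.1 y]
  linear_combination (α x y) * hc

lemma antiInvariant_of_mem_forms20_sup_forms02 {α : Bil V ℂ} (hα : α ∈ forms20 J ⊔ forms02 J) :
    α ∈ twoForms V ℂ ∧ ∀ x y, α (J x) (J y) = -α x y := by
  obtain ⟨β, hβ, γ, hγ, rfl⟩ := Submodule.mem_sup.1 hα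
  refine ⟨add_mem hβ.1 hγ.1, fun x y => ?_⟩
  simp only [LinearMap.add_apply, map_map_eq_neg_of_mem_formsOfWeight (by simp) hβ,
    map_map_eq_neg_of_mem_formsOfWeight (by simp) hγ]
  ring

/-- The `J`-anti-invariant two-forms are the sums of forms of type `(2,0)` and `(0,2)`. -/
lemma mem_forms20_sup_forms02 (hJ : ∀ x, J (J x) = -x) {α : Bil V ℂ} (hα : α ∈ twoForms V ℂ)
    (h : ∀ x y, α (J x) (J y) = -α x y) : α ∈ forms20 J ⊔ forms02 J := by
  have hflip : ∀ x y, α x (J y) = α (J x) y := fun x y => by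
    have := h x (J y)
    rw [hJ, map_neg, neg_inj] at this
    exact this.symm
  have hself : ∀ x, α (J x) x = 0 := fun x => by
    have h1 := hflip x x
    rw [neg_apply_swap_of_mem_twoForms hα] at h1
    exact self_eq_neg.mp h1.symm
  -- the two parts are `(α(x, y) ∓ i α(Jx, y)) / 2`
  have part : ∀ c : ℂ, c * c = -1 →
      ((1 / 2 : ℂ) • α - (c / 2) • α.comp J : Bil V ℂ) ∈ formsOfWeight J c := by
    intro c hc
    refine ⟨fun x => ?_, fun x y => ?_⟩
    · simp [hself x, apply_self_of_mem_twoForms hα]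
    · simp only [LinearMap.sub_apply, LinearMap.smul_apply, LinearMap.comp_apply, hJ, map_neg,
        LinearMap.neg_apply, smul_eq_mul]
      linear_combination ((1 / 2) * α (J x) y) * hc
  refine Submodule.mem_sup.2 ⟨_, part Complex.I (by simp), _, part (-Complex.I) (by simp), ?_⟩
  ext x y
  simp only [LinearMap.add_apply, LinearMap.sub_apply, LinearMap.smul_apply, LinearMap.comp_apply,
    smul_eq_mul]
  ring

/-- The derivation `(x, y) ↦ α(Jx, y) + α(x, Jy)` induced by `J` on bilinear forms. -/
noncomputable def derivJ (J : V →ₗ[ℝ] V) : Module.End ℂ (Bil V ℂ) where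
  toFun α := α.comp J + α.compl₂ J
  map_add' := by intros; ext; simp; ring
  map_smul' := by intros; ext; simp

lemma formsOfWeight_le_eigenspace (c : ℂ) :
    formsOfWeight J c ≤ Module.End.eigenspace (derivJ J) (2 * c) := by
  intro α hα
  rw [Module.End.mem_eigenspace_iff]
  ext x y
  have h : α x (J y) = c * α x y := by
    rw [neg_apply_swap_of_mem_twoForms hα.1, hα.2, neg_apply_swap_of_mem_twoForms hα.1 x]
    ring
  simp only [derivJ, LinearMap.coe_mk, AddHom.coe_mk, LinearMap.add_apply, LinearMap.comp_apply,
    LinearMap.compl₂_apply, LinearMap.smul_apply, smul_eq_mul, hα.2, h]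
  ring

end Weights

variable {V : Type*} [NormedAddCommGroup V] [InnerProductSpace ℝ V] {J : V →ₗ[ℝ] V}

lemma span_fundamentalForm_le_eigenspace (hJ : IsOrthogonalComplexStructure J) :
    ℂ ∙ fundamentalForm ℂ J ≤ Module.End.eigenspace (derivJ J) 0 := by
  rw [Submodule.span_singleton_le_iff_mem, Module.End.mem_eigenspace_iff]
  ext x y
  simp [derivJ, fundamentalForm, hJ.map_map, hJ.inner_map_map]

/-- The three summands lie in eigenspaces of `derivJ J` for the eigenvalues `0`, `2i`, `-2i`. -/
theorem iSupIndep_formsOfWeight (hJ : IsOrthogonalComplexStructure J) :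
    iSupIndep ![ℂ ∙ fundamentalForm ℂ J, forms20 J, forms02 J] := by
  have hinj : Function.Injective ![0, 2 * Complex.I, 2 * -Complex.I] := by
    intro i j h
    fin_cases i <;> fin_cases j <;> simp [Complex.ext_iff] at h ⊢ <;> norm_num at h
  refine ((Module.End.eigenspaces_iSupIndep (derivJ J)).comp hinj).mono fun i => ?_
  fin_cases i
  · exact span_fundamentalForm_le_eigenspace hJ
  · exact formsOfWeight_le_eigenspace Complex.I
  · exact formsOfWeight_le_eigenspace (-Complex.I)

variable [FiniteDimensional ℝ V] [Fact (finrank ℝ V = 4)] {o : Orientation ℝ V (Fin 4)}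
  {b : OrthonormalBasis (Fin 4) ℝ V}

section Adapted

variable (hJ : IsOrthogonalComplexStructure J) (hb : IsAdapted J o b)
include hJ hb

theorem selfDualForms_eq_sup :
    selfDualForms ℂ o = (ℂ ∙ fundamentalForm ℂ J) ⊔ forms20 J ⊔ forms02 J := by
  obtain ⟨w1, w2, w3, w4, w5, w6⟩ := fundamentalForm_components (K := ℂ) hJ hb
  have hw := fundamentalForm_mem_twoForms (K := ℂ) hJ
  rw [sup_assoc]
  apply le_antisymm
  · intro β hβ
    obtain ⟨hβ, a1, a2, a3⟩ := (mem_selfDualForms_iff hb.orientation_eq).1 hβ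
    refine Submodule.mem_sup.2 ⟨β (b 0) (b 1) • fundamentalForm ℂ J,
      Submodule.smul_mem _ _ (Submodule.mem_span_singleton_self _),
      β - β (b 0) (b 1) • fundamentalForm ℂ J, ?_, add_sub_cancel _ _⟩
    have hγ : β - β (b 0) (b 1) • fundamentalForm ℂ J ∈ twoForms V ℂ :=
      sub_mem hβ (Submodule.smul_mem _ _ hw)
    refine mem_forms20_sup_forms02 hJ.map_map hγ ?_
    generalize hγ' : β - β (b 0) (b 1) • fundamentalForm ℂ J = γ at hγ
    have c1 : γ (b 0) (b 1) = 0 := by simp [← hγ', w1]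
    have c2 : γ (b 2) (b 3) = 0 := by simp [← hγ', w6, a1]
    have c3 : γ (b 1) (b 3) = -γ (b 0) (b 2) := by simp [← hγ', w2, w5, a2]
    have c4 : γ (b 1) (b 2) = γ (b 0) (b 3) := by simp [← hγ', w3, w4, a3]
    have hm : (γ.comp J).compl₂ J ∈ twoForms V ℂ := fun x => hγ (J x)
    have key : (γ.comp J).compl₂ J = -γ := by
      refine twoForms_ext b hm (neg_mem hγ) ?_ ?_ ?_ ?_ ?_ ?_ <;>
        simp [hb.map_zero, hb.map_two, hb.map_one hJ, hb.map_three hJ,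
          neg_apply_swap_of_mem_twoForms hγ (b 1) (b 0),
          neg_apply_swap_of_mem_twoForms hγ (b 3) (b 2),
          c1, c2, c3, c4]
    exact fun x y => congrArg (fun δ : Bil V ℂ => δ x y) key
  · refine sup_le ?_ fun α hα => ?_
    · rw [Submodule.span_singleton_le_iff_mem]
      exact fundamentalForm_mem_selfDualForms hJ hb
    · obtain ⟨h, h'⟩ := antiInvariant_of_mem_forms20_sup_forms02 hα
      exact antiInvariant_mem_selfDualForms hJ hb h h'

omit [Fact (finrank ℝ V = 4)] in
lemma formInner_antiInvariant_fundamentalForm {α : Bil V ℂ} (hα : α ∈ twoForms V ℂ)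
    (h : ∀ x y, α (J x) (J y) = -α x y) : formInner α (fundamentalForm ℂ J) = 0 := by
  obtain ⟨w1, w2, w3, w4, w5, w6⟩ := fundamentalForm_components (K := ℂ) hJ hb
  obtain ⟨c1, c2, -, -⟩ := antiInvariant_components hJ hb hα h
  have hw := fundamentalForm_mem_twoForms (K := ℂ) hJ
  rw [formInner_complex_orthonormalBasis b]
  simp [Fin.sum_univ_four, apply_self_of_mem_twoForms hw, w1, w2, w3, w4, w5, w6,
    c1, c2, neg_apply_swap_of_mem_twoForms hα (b 1) (b 0),
    neg_apply_swap_of_mem_twoForms hα (b 3) (b 2),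
    neg_apply_swap_of_mem_twoForms hw (b 2) (b 0), neg_apply_swap_of_mem_twoForms hw (b 3) (b 0),
    neg_apply_swap_of_mem_twoForms hw (b 2) (b 1), neg_apply_swap_of_mem_twoForms hw (b 3) (b 1)]

omit [Fact (finrank ℝ V = 4)] in
lemma formInner_forms20_forms02 {α β : Bil V ℂ} (hα : α ∈ forms20 J) (hβ : β ∈ forms02 J) :
    formInner α β = 0 := by
  have comp : ∀ (c : ℂ), c * c = -1 → ∀ γ ∈ formsOfWeight J c,
      γ (b 0) (b 1) = 0 ∧ γ (b 2) (b 3) = 0 ∧ γ (b 1) (b 3) = -γ (b 0) (b 2) ∧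
        γ (b 1) (b 2) = c * γ (b 0) (b 2) ∧ γ (b 0) (b 3) = c * γ (b 0) (b 2) := by
    intro c hc γ hγ
    obtain ⟨c1, c2, c3, c4⟩ := antiInvariant_components hJ hb hγ.1
      (map_map_eq_neg_of_mem_formsOfWeight hc hγ)
    have c5 : γ (b 1) (b 2) = c * γ (b 0) (b 2) := by rw [← hb.map_zero, hγ.2]
    exact ⟨c1, c2, c3, c5, c4 ▸ c5⟩
  obtain ⟨a1, a2, a3, a4, a5⟩ := comp _ (by simp) α hα
  obtain ⟨b1, b2, b3, b4, b5⟩ := comp _ (by simp) β hβ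
  rw [formInner_complex_orthonormalBasis b]
  simp only [Fin.sum_univ_four, apply_self_of_mem_twoForms hα.1,
    neg_apply_swap_of_mem_twoForms hα.1 (b 1) (b 0),
    neg_apply_swap_of_mem_twoForms hα.1 (b 3) (b 2),
    neg_apply_swap_of_mem_twoForms hα.1 (b 2) (b 0),
    neg_apply_swap_of_mem_twoForms hα.1 (b 3) (b 0),
    neg_apply_swap_of_mem_twoForms hα.1 (b 2) (b 1),
    neg_apply_swap_of_mem_twoForms hα.1 (b 3) (b 1),
    neg_apply_swap_of_mem_twoForms hβ.1 (b 2) (b 0),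
    neg_apply_swap_of_mem_twoForms hβ.1 (b 3) (b 0),
    neg_apply_swap_of_mem_twoForms hβ.1 (b 2) (b 1),
    neg_apply_swap_of_mem_twoForms hβ.1 (b 3) (b 1), a1, a2, a3, a4, a5, b3, b4, b5,
    map_neg, map_mul, Complex.conj_I, neg_neg]
  linear_combination (2 * α (b 0) (b 2) * starRingEnd ℂ (β (b 0) (b 2))) * Complex.I_mul_I

end Adapted

/-! ### Adapted bases -/

omit [Fact (finrank ℝ V = 4)] in
/-- An orthogonal complex structure on a four-dimensional space has an orthonormal basis of the
form `(e, Je, f, Jf)`. -/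
lemma exists_orthonormalBasis_map (h4 : finrank ℝ V = 4) (hJ : IsOrthogonalComplexStructure J) :
    ∃ b : OrthonormalBasis (Fin 4) ℝ V, J (b 0) = b 1 ∧ J (b 2) = b 3 := by
  have hskew : ∀ x y, inner ℝ x (J y) = -inner ℝ (J x) y := fun x y => by
    rw [← hJ.inner_map_map x, hJ.map_map, inner_neg_right]
  have hself : ∀ x, inner ℝ x (J x) = 0 := fun x => by
    have := hskew x x
    rw [real_inner_comm x (J x)] at this
    linarith
  have hnorm : ∀ x, ‖J x‖ = ‖x‖ := fun x => by
    rw [norm_eq_sqrt_real_inner, hJ.inner_map_map, ← norm_eq_sqrt_real_inner]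
  have : Nontrivial V := nontrivial_of_finrank_pos (R := ℝ) (by omega)
  obtain ⟨u', hu'⟩ := exists_ne (0 : V)
  set u := ‖u'‖⁻¹ • u'
  have hu : ‖u‖ = 1 := norm_smul_inv_norm (𝕜 := ℝ) hu'
  obtain ⟨v', hv', hv'0⟩ : ∃ v' ∈ (Submodule.span ℝ {u, J u})ᗮ, v' ≠ 0 := by
    rw [← Submodule.ne_bot_iff, Ne, Submodule.orthogonal_eq_bot_iff]
    intro h
    have h2 : finrank ℝ (Submodule.span ℝ ({u, J u} : Set V)) ≤ 2 := by
      classical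
      have h3 := finrank_span_finset_le_card (R := ℝ) ({u, J u} : Finset V)
      rw [Finset.coe_pair] at h3
      exact h3.trans Finset.card_le_two
    rw [h, finrank_top] at h2
    omega
  set v := ‖v'‖⁻¹ • v' with hv_def
  have hv : ‖v‖ = 1 := norm_smul_inv_norm (𝕜 := ℝ) hv'0
  have huv : inner ℝ u v = 0 := by
    rw [hv_def, inner_smul_right, (Submodule.mem_orthogonal _ _).1 hv' u
      (Submodule.subset_span (by simp)), mul_zero]
  have hJuv : inner ℝ (J u) v = 0 := by
    rw [hv_def, inner_smul_right, (Submodule.mem_orthogonal _ _).1 hv' (J u)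
      (Submodule.subset_span (by simp)), mul_zero]
  have horth : Orthonormal ℝ ![u, J u, v, J v] := by
    rw [orthonormal_iff_ite]
    intro i j
    fin_cases i <;> fin_cases j <;>
      simp [hu, hv, hnorm, huv, hJuv, hself, hskew u v, hJ.inner_map_map, real_inner_comm u v,
        real_inner_comm (J u) v, real_inner_comm u (J u), real_inner_comm v (J v),
        real_inner_comm u (J v)]
  refine ⟨(basisOfOrthonormalOfCardEqFinrank horth (by simp [h4])).toOrthonormalBasis
    (by simpa using horth), ?_, ?_⟩ <;> simp

/-- A real basis of `ℂ²` of the form `(e, ie, f, if)` has the orientation of the standard one: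
the complex-linear map taking one basis to the other has real determinant `|det|²`. -/
lemma orientation_eq_realBasis_orientation (e : Basis (Fin 4) ℝ C2)
    (h1 : e 1 = Complex.I • e 0) (h3 : e 3 = Complex.I • e 2) :
    e.orientation = realBasis.orientation := by
  let A : C2 →ₗ[ℂ] C2 := (EuclideanSpace.basisFun (Fin 2) ℂ).toBasis.constr ℂ ![e 0, e 2]
  have hA0 : A (EuclideanSpace.single 0 1) = e 0 := by
    have := (EuclideanSpace.basisFun (Fin 2) ℂ).toBasis.constr_basis ℂ ![e 0, e 2] 0
    rwa [OrthonormalBasis.coe_toBasis, EuclideanSpace.basisFun_apply] at this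
  have hA1 : A (EuclideanSpace.single 1 1) = e 2 := by
    have := (EuclideanSpace.basisFun (Fin 2) ℂ).toBasis.constr_basis ℂ ![e 0, e 2] 1
    rwa [OrthonormalBasis.coe_toBasis, EuclideanSpace.basisFun_apply] at this
  have hI : ∀ i : Fin 2, (EuclideanSpace.single i Complex.I : C2) =
      Complex.I • EuclideanSpace.single i 1 := fun i => by
    ext j
    simp
  have hA : ⇑e = A.restrictScalars ℝ ∘ realBasis := by
    funext i
    rw [realBasis_eq]
    fin_cases i
    · exact hA0.symm
    · simp [hI, hA0, h1]
    · exact hA1.symm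
    · simp [hI, hA1, h3]
  have hdet : realBasis.det e = ‖LinearMap.det A‖ ^ 2 := by
    rw [hA, Basis.det_comp, Basis.det_self, mul_one, LinearMap.det_restrictScalars,
      Algebra.norm_complex_apply, Complex.normSq_eq_norm_sq]
  rw [eq_comm, Basis.orientation_eq_iff_det_pos]
  exact lt_of_le_of_ne (by rw [hdet]; positivity) (realBasis.isUnit_det e).ne_zero.symm

end Algebra

/-! ### The Levi-Civita connection in coordinates -/

section Local

variable {E : Type*} [NormedAddCommGroup E] [NormedSpace ℝ E]

lemma fderiv_bilin_apply {g : E → E →L[ℝ] E →L[ℝ] ℝ} {y : E} (hg : DifferentiableAt ℝ g y)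
    (u v w : E) : fderiv ℝ (fun z => g z v w) y u = fderiv ℝ g y u v w := by
  rw [((hg.hasFDerivAt.clm_apply (hasFDerivAt_const v y)).clm_apply (hasFDerivAt_const w y)).fderiv]
  simp

/-- The Koszul formula for the Christoffel symbols. Invertibility of `g y` excludes the junk value
of the inverse in their definition. -/
lemma metric_christoffel {g : E → E →L[ℝ] E →L[ℝ] ℝ} {y : E} (hinv : (g y).IsInvertible)
    (u v w : E) :
    g y (christoffel g y u v) w = (1 / 2) * (fderiv ℝ g y u v w
      + fderiv ℝ g y v u w - fderiv ℝ g y w u v) := by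
  rw [christoffel_apply, ← christoffelLower_apply]
  obtain ⟨e, he⟩ := hinv
  rw [← he, ContinuousLinearMap.inverse_equiv]
  simp

variable {g : E → E →L[ℝ] E →L[ℝ] ℝ} {U : Set E}

/-- A smooth metric on an open subset of a vector space: a symmetric nondegenerate field of
bilinear forms. Positivity plays no role in the local computations. -/
structure IsMetricOn (g : E → E →L[ℝ] E →L[ℝ] ℝ) (U : Set E) : Prop where
  isOpen : IsOpen U
  contDiffOn : ContDiffOn ℝ ∞ g U
  symm : ∀ y ∈ U, ∀ u v, g y u v = g y v u
  isInvertible : ∀ y ∈ U, (g y).IsInvertible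

namespace IsMetricOn

variable (hg : IsMetricOn g U) {y : E} (hy : y ∈ U)
include hg hy

lemma contDiffAt : ContDiffAt ℝ ∞ g y := hg.contDiffOn.contDiffAt (hg.isOpen.mem_nhds hy)

lemma differentiableAt : DifferentiableAt ℝ g y := (hg.contDiffAt hy).differentiableAt (by simp)

lemma eq_of_forall {a a' : E} (h : ∀ w, g y a w = g y a' w) : a = a' := by
  obtain ⟨e, he⟩ := hg.isInvertible y hy
  apply e.injective
  ext w
  simpa [← he] using h w

lemma fderiv_symm (u v w : E) : fderiv ℝ g y u v w = fderiv ℝ g y u w v := by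
  rw [← fderiv_bilin_apply (hg.differentiableAt hy), ← fderiv_bilin_apply (hg.differentiableAt hy)]
  congr 1
  refine Filter.EventuallyEq.fderiv_eq ?_
  filter_upwards [hg.isOpen.mem_nhds hy] with z hz using hg.symm z hz v w

lemma christoffel_symm (u v : E) : christoffel g y u v = christoffel g y v u := by
  refine hg.eq_of_forall hy fun w => ?_
  rw [metric_christoffel (hg.isInvertible y hy), metric_christoffel (hg.isInvertible y hy),
    hg.fderiv_symm hy w u v]
  ring

/-- Compatibility of the Levi-Civita connection with the metric. -/
lemma fderiv_eq_christoffel (u v w : E) :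
    fderiv ℝ g y u v w = g y (christoffel g y u v) w + g y v (christoffel g y u w) := by
  rw [hg.symm y hy v, metric_christoffel (hg.isInvertible y hy),
    metric_christoffel (hg.isInvertible y hy), hg.fderiv_symm hy u w v]
  ring

lemma contDiffAt_christoffel [CompleteSpace E] : ContDiffAt ℝ ∞ (christoffel g) y := by
  have hD : ContDiffAt ℝ ∞ (fderiv ℝ g) y := (hg.contDiffAt hy).fderiv_right (by simp)
  have hlower : ContDiffAt ℝ ∞ (christoffelLower g) y := by
    unfold christoffelLower
    have hflip : ContDiffAt ℝ ∞ (fun z => (fderiv ℝ g z).flip) y :=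
      (ContinuousLinearMap.flipₗᵢ ℝ E E (E →L[ℝ] ℝ)).contDiff.contDiffAt.comp y hD
    exact ((hD.add hflip).sub (contDiffAt_const.clm_comp hflip)).const_smul (1 / 2 : ℝ)
  have hinv : ContDiffAt ℝ ∞ (fun z => (g z).inverse) y := by
    obtain ⟨e, he⟩ := hg.isInvertible y hy
    have := contDiffAt_map_inverse (n := ∞) e
    rw [he] at this
    exact this.comp y (hg.contDiffAt hy)
  exact ((ContinuousLinearMap.compL ℝ E (E →L[ℝ] ℝ) E).contDiff.contDiffAt.comp y hinv).clm_comp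
    hlower

end IsMetricOn

lemma localCurvature_apply (u v w : E) (y : E) :
    localCurvature g y u v w = fderiv ℝ (christoffel g) y u v w - fderiv ℝ (christoffel g) y v u w +
      christoffel g y u (christoffel g y v w) - christoffel g y v (christoffel g y u w) := rfl

lemma localCurvature_swap (u v w : E) (y : E) :
    localCurvature g y u v w = -localCurvature g y v u w := by
  simp only [localCurvature_apply]
  abel

lemma metric_localCurvature_swap₁₂ (y X Y Z W : E) :
    g y Z (localCurvature g y X Y W) = -g y Z (localCurvature g y Y X W) := by
  rw [localCurvature_swap, map_neg]

namespace IsMetricOn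

variable [CompleteSpace E] (hg : IsMetricOn g U) {y : E} (hy : y ∈ U)
include hg hy

lemma differentiableAt_christoffel : DifferentiableAt ℝ (christoffel g) y :=
  (hg.contDiffAt_christoffel hy).differentiableAt (by simp)

lemma hasFDerivAt_christoffel_apply (u v : E) :
    HasFDerivAt (fun z => christoffel g z u v)
      (((fderiv ℝ (christoffel g) y).flip u).flip v) y := by
  have h := (((hg.differentiableAt_christoffel hy).hasFDerivAt.clm_apply
    (hasFDerivAt_const u y)).clm_apply (hasFDerivAt_const v y))
  convert h using 1
  ext
  simp

lemma fderiv_metric_christoffel (a u v w : E) :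
    fderiv ℝ (fun z => g z (christoffel g z u v) w) y a =
      fderiv ℝ g y a (christoffel g y u v) w + g y (fderiv ℝ (christoffel g) y a u v) w := by
  rw [(((hg.differentiableAt hy).hasFDerivAt.clm_apply
    (hg.hasFDerivAt_christoffel_apply hy u v)).clm_apply (hasFDerivAt_const w y)).fderiv]
  simp
  ring

/-- The first Bianchi identity, from the symmetry of the Christoffel symbols and hence of their
derivatives. -/
lemma localCurvature_bianchi (u v w : E) :
    localCurvature g y u v w + localCurvature g y v w u + localCurvature g y w u v = 0 := by
  have h : ∀ a u v, fderiv ℝ (christoffel g) y a u v = fderiv ℝ (christoffel g) y a v u := by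
    intro a u v
    have h1 := (hg.hasFDerivAt_christoffel_apply hy u v).fderiv
    have h2 := (hg.hasFDerivAt_christoffel_apply hy v u).fderiv
    have h3 : fderiv ℝ (fun z => christoffel g z u v) y =
        fderiv ℝ (fun z => christoffel g z v u) y := by
      refine Filter.EventuallyEq.fderiv_eq ?_
      filter_upwards [hg.isOpen.mem_nhds hy] with z hz using hg.christoffel_symm hz u v
    rw [h1, h2] at h3
    exact congrArg (fun L : E →L[ℝ] E => L a) h3
  simp only [localCurvature_apply]
  rw [h v u w, h w v u, h u w v, hg.christoffel_symm hy w u, hg.christoffel_symm hy w v,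
    hg.christoffel_symm hy v u]
  abel

/-- The curvature is skew-symmetric with respect to the metric: this is the symmetry of the second
derivative of `g`, expressed through the Christoffel symbols. -/
lemma metric_localCurvature_skew (a u v w : E) :
    g y (localCurvature g y a u v) w = -g y v (localCurvature g y a u w) := by
  have hsnd : IsSymmSndFDerivAt ℝ g y := (hg.contDiffAt hy).isSymmSndFDerivAt 
    (by rw [minSmoothness_of_isRCLikeNormedField]; exact WithTop.coe_le_coe.2 le_top)
  have hD : DifferentiableAt ℝ (fderiv ℝ g) y :=
    ((hg.contDiffAt hy).fderiv_right (m := ∞) (by simp)).differentiableAt (by simp)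
  have key : ∀ a u v w, fderiv ℝ (fderiv ℝ g) y a u v w =
      fderiv ℝ g y a (christoffel g y u v) w + g y (fderiv ℝ (christoffel g) y a u v) w +
      (fderiv ℝ g y a (christoffel g y u w) v + g y (fderiv ℝ (christoffel g) y a u w) v) := by
    intro a u v w
    have h1 : fderiv ℝ (fderiv ℝ g) y a u v w = fderiv ℝ (fun z => fderiv ℝ g z u v w) y a := by
      rw [(((hD.hasFDerivAt.clm_apply (hasFDerivAt_const u y)).clm_apply
        (hasFDerivAt_const v y)).clm_apply (hasFDerivAt_const w y)).fderiv]
      simp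
    have h2 : (fun z => fderiv ℝ g z u v w) =ᶠ[nhds y]
        (fun z => g z (christoffel g z u v) w + g z (christoffel g z u w) v) := by
      filter_upwards [hg.isOpen.mem_nhds hy] with z hz
      rw [hg.fderiv_eq_christoffel hz, hg.symm z hz v]
    have hdiff : ∀ v w, DifferentiableAt ℝ (fun z => g z (christoffel g z u v) w) y := fun v w =>
      (((hg.differentiableAt hy).hasFDerivAt.clm_apply
        (hg.hasFDerivAt_christoffel_apply hy u v)).clm_apply
          (hasFDerivAt_const w y)).differentiableAt
    rw [h1, h2.fderiv_eq, fderiv_fun_add (hdiff v w) (hdiff w v)]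
    simp only [add_apply, hg.fderiv_metric_christoffel hy]
  have hs : fderiv ℝ (fderiv ℝ g) y a u v w = fderiv ℝ (fderiv ℝ g) y u a v w := by
    rw [hsnd a u]
  rw [key, key] at hs
  simp only [hg.fderiv_eq_christoffel hy] at hs
  rw [hg.symm y hy v]
  simp only [localCurvature_apply, map_add, map_sub, add_apply,
    sub_apply]
  rw [hg.symm y hy (christoffel g y u v), hg.symm y hy (christoffel g y a v)] at hs
  linarith

end IsMetricOn

/-! ### Kähler metrics in coordinates -/

/-- A metric is Kähler with respect to a constant complex structure `J` if it is `J`-Hermitian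
with closed fundamental form. -/
structure IsKaehlerOn (J : E →L[ℝ] E) (g : E → E →L[ℝ] E →L[ℝ] ℝ) (U : Set E) : Prop
    extends IsMetricOn g U where
  map_map : ∀ x, J (J x) = -x
  hermitian : ∀ y ∈ U, ∀ u v, g y (J u) (J v) = g y u v
  closed : ∀ y ∈ U, ∀ u v w, dTwoForm (fun z => (g z).comp J) y u v w = 0

namespace IsKaehlerOn

variable {J : E →L[ℝ] E} (hg : IsKaehlerOn J g U) {y : E} (hy : y ∈ U)
include hg hy

lemma metric_J_left (u v : E) : g y (J u) v = -g y u (J v) := by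
  rw [← hg.hermitian y hy u, hg.map_map, map_neg, neg_neg]

lemma fderiv_J_left (a u v : E) : fderiv ℝ g y a (J u) v = -fderiv ℝ g y a u (J v) := by
  have hd := hg.differentiableAt hy
  rw [← fderiv_bilin_apply hd, ← fderiv_bilin_apply hd, ← neg_apply,
    ← fderiv_fun_neg]
  congr 1
  refine Filter.EventuallyEq.fderiv_eq ?_
  filter_upwards [hg.isOpen.mem_nhds hy] with z hz using hg.metric_J_left hz u v

/-- The equation `dω = 0` in terms of the derivative of the metric. -/
lemma fderiv_cyclic (u v w : E) :
    fderiv ℝ g y u (J v) w + fderiv ℝ g y v (J w) u + fderiv ℝ g y w (J u) v = 0 := by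
  have h : fderiv ℝ (fun z => (g z).comp J) y =
      (ContinuousLinearMap.compL ℝ E E (E →L[ℝ] ℝ)).flip J ∘L fderiv ℝ g y :=
    (((ContinuousLinearMap.compL ℝ E E (E →L[ℝ] ℝ)).flip J).hasFDerivAt.comp y
      (hg.differentiableAt hy).hasFDerivAt).fderiv
  have := hg.closed y hy u v w
  rw [dTwoForm, h] at this
  simpa using this

/-- The complex structure of a Kähler metric is parallel: the covariant derivative of `J` is
determined by `dω`. -/
lemma christoffel_J (u v : E) : christoffel g y u (J v) = J (christoffel g y u v) := by
  refine hg.eq_of_forall hy fun w => ?_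
  rw [hg.metric_J_left hy, metric_christoffel (hg.isInvertible y hy),
    metric_christoffel (hg.isInvertible y hy)]
  -- `2 g((∇_u J)v, w) = dω(u, v, w) - dω(u, Jv, Jw)`,
  -- as the Nijenhuis tensor of a constant `J` vanishes
  have h1 := hg.fderiv_cyclic hy u v w
  have h2 := hg.fderiv_cyclic hy u (J v) (J w)
  simp only [hg.map_map, map_neg, neg_apply] at h2
  have s := fun a b c => hg.fderiv_symm hy a b c
  have j := fun a b c => hg.fderiv_J_left hy a b c
  have e1 := j u v w
  have e2 := j w u v
  have e3 := j v w u
  have e4 := j (J w) u (J v)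
  rw [hg.map_map, map_neg] at e4
  linarith [s w u (J v), s v u (J w), s v w (J u), s v (J w) u, s (J v) w u, s (J w) u v]

variable [CompleteSpace E]

/-- The curvature endomorphisms of a Kähler metric commute with `J`, by differentiating the
identity `Γ(u, Jv) = JΓ(u, v)`. -/
lemma localCurvature_J (u v w : E) :
    localCurvature g y u v (J w) = J (localCurvature g y u v w) := by
  have h : ∀ a u v, fderiv ℝ (christoffel g) y a u (J v) =
      J (fderiv ℝ (christoffel g) y a u v) := by
    intro a u v
    have h1 := (hg.hasFDerivAt_christoffel_apply hy u (J v)).fderiv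
    have h2 := (J.hasFDerivAt.comp y (hg.hasFDerivAt_christoffel_apply hy u v)).fderiv
    have h3 : fderiv ℝ (fun z => christoffel g z u (J v)) y =
        fderiv ℝ (J ∘ fun z => christoffel g z u v) y := by
      refine Filter.EventuallyEq.fderiv_eq ?_
      filter_upwards [hg.isOpen.mem_nhds hy] with z hz using hg.christoffel_J hz u v
    rw [h1, h2] at h3
    exact congrArg (fun L : E →L[ℝ] E => L a) h3
  simp only [localCurvature_apply, h, hg.christoffel_J hy, map_add, map_sub]

lemma metric_localCurvature_swap₃₄ (X Y Z W : E) :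
    g y Z (localCurvature g y X Y W) = -g y W (localCurvature g y X Y Z) := by
  rw [hg.symm y hy Z, hg.metric_localCurvature_skew hy]

lemma metric_localCurvature_bianchi (X Y Z W : E) :
    g y Z (localCurvature g y X Y W) + g y X (localCurvature g y Y Z W) +
      g y Y (localCurvature g y Z X W) = 0 := by
  rw [hg.metric_localCurvature_swap₃₄ hy X Y, hg.metric_localCurvature_swap₃₄ hy Y Z,
    hg.metric_localCurvature_swap₃₄ hy Z X, ← neg_add, ← neg_add, ← map_add, ← map_add,
    hg.localCurvature_bianchi hy, map_zero, neg_zero]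

lemma metric_localCurvature_J (X Y Z W : E) :
    g y (J Z) (localCurvature g y X Y (J W)) = g y Z (localCurvature g y X Y W) := by
  rw [hg.localCurvature_J hy, hg.hermitian y hy]

omit hy [CompleteSpace E] in
/-- The Kähler condition is invariant under linear changes of coordinates. -/
theorem pullback {F : Type*} [NormedAddCommGroup F] [NormedSpace ℝ F] (φ : F ≃L[ℝ] E) :
    IsKaehlerOn ((φ.symm : E →L[ℝ] F) ∘L J ∘L (φ : F →L[ℝ] E))
      (fun y => (g (φ y)).bilinearComp (φ : F →L[ℝ] E) (φ : F →L[ℝ] E)) (φ ⁻¹' U) := by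
  have hcd : ContDiffOn ℝ ∞
      (fun y => (g (φ y)).bilinearComp (φ : F →L[ℝ] E) (φ : F →L[ℝ] E)) (φ ⁻¹' U) := by
    have h1 : ContDiffOn ℝ ∞ (fun y => g (φ y)) (φ ⁻¹' U) :=
      hg.contDiffOn.comp φ.contDiff.contDiffOn fun _ h => h
    have h2 := (ContinuousLinearMap.flipₗᵢ ℝ F E ℝ).contDiff.comp_contDiffOn
      (h1.clm_comp (contDiffOn_const (c := (φ : F →L[ℝ] E))))
    exact (ContinuousLinearMap.flipₗᵢ ℝ F F ℝ).contDiff.comp_contDiffOn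
      (h2.clm_comp (contDiffOn_const (c := (φ : F →L[ℝ] E))))
  have hopen : IsOpen (φ ⁻¹' U) := hg.isOpen.preimage φ.continuous
  refine ⟨⟨hopen, hcd, fun y hy u v => hg.symm _ hy _ _, fun y hy => ?_⟩, fun u => ?_,
    fun y hy u v => ?_, fun y hy u v w => ?_⟩
  · obtain ⟨e, he⟩ := hg.isInvertible _ hy
    refine ⟨φ.trans (e.trans (φ.symm.arrowCongr (ContinuousLinearEquiv.refl ℝ ℝ))), ?_⟩
    ext u v
    simp [← he]
  · simp [hg.map_map]
  · simp [hg.hermitian _ hy]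
  · have hd := ((hcd.contDiffAt (hopen.mem_nhds hy)).differentiableAt (by simp))
    have key : ∀ u v w, fderiv ℝ (fun z => ((g (φ z)).bilinearComp (φ : F →L[ℝ] E)
        (φ : F →L[ℝ] E)).comp ((φ.symm : E →L[ℝ] F) ∘L J ∘L (φ : F →L[ℝ] E))) y u v w =
        fderiv ℝ (fun z => (g z).comp J) (φ y) (φ u) (φ v) (φ w) := by
      intro u v w
      rw [← fderiv_bilin_apply, ← fderiv_bilin_apply]
      · have : DifferentiableAt ℝ (fun z => (g z).comp J (φ v) (φ w)) (φ y) :=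
          (((hg.differentiableAt hy).clm_apply (differentiableAt_const _)).clm_apply
            (differentiableAt_const _))
        have h := (this.hasFDerivAt.comp y φ.hasFDerivAt).fderiv
        refine Eq.trans ?_ (congrArg (fun L : F →L[ℝ] ℝ => L u) h)
        congr 2
        ext z
        simp
      · exact (hg.differentiableAt hy).clm_comp (differentiableAt_const _)
      · exact hd.clm_comp (differentiableAt_const _)
    rw [dTwoForm, key, key, key]
    exact hg.closed _ hy _ _ _

end IsKaehlerOn

end Local

/-! ### Complex surfaces -/

section Manifold

open Bundle

variable {M : Type*} [TopologicalSpace M] [ChartedSpace C2 M] [IsManifold 𝓘(ℂ, C2) ω M]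

lemma contDiffOn_chartAt_comp_symm (x p : M) :
    ContDiffOn ℂ ω (chartAt C2 p ∘ (chartAt C2 x).symm)
      ((chartAt C2 x).symm.trans (chartAt C2 p)).source := by
  have h := (contDiffGroupoid ω 𝓘(ℂ, C2)).compatible
    (chart_mem_atlas C2 x) (chart_mem_atlas C2 p)
  rw [contDiffGroupoid, mem_groupoid_of_pregroupoid] at h
  simpa [contDiffPregroupoid] using h.1

lemma mdifferentiableAt_chartAt_symm (x : M) {y : C2} (hy : y ∈ (chartAt C2 x).target) :
    MDifferentiableAt 𝓘(ℝ, C2) 𝓘(ℝ, C2) (chartAt C2 x).symm y :=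
  ((contMDiffOn_chart_symm (n := ∞)).contMDiffAt
    ((chartAt C2 x).open_target.mem_nhds hy)).mdifferentiableAt (by simp)

lemma dChartInv_eq_fderiv (x : M) {y : C2} (hy : y ∈ (chartAt C2 x).target) :
    (dChartInv x y : C2 →L[ℝ] C2) =
      fderiv ℝ (chartAt C2 ((chartAt C2 x).symm y) ∘ (chartAt C2 x).symm) y := by
  have h := (mdifferentiableAt_chartAt_symm x hy).mfderiv
  simp only [writtenInExtChartAt, mfld_simps, fderivWithin_univ] at h
  exact h

/-- The transition maps are holomorphic, so the derivatives of the charts are complex linear. -/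
lemma dChartInv_smul_I (x : M) {y : C2} (hy : y ∈ (chartAt C2 x).target) (u : C2) :
    dChartInv x y (Complex.I • u) = J _ (dChartInv x y u) := by
  have hd : DifferentiableAt ℂ
      (chartAt C2 ((chartAt C2 x).symm y) ∘ (chartAt C2 x).symm) y := by
    refine ((contDiffOn_chartAt_comp_symm x _).contDiffAt
      (((chartAt C2 x).symm.trans _).open_source.mem_nhds ?_)).differentiableAt (by simp)
    simp [hy]
  let D : C2 →L[ℝ] C2 := dChartInv x y
  have key : ∀ v : C2, D v =
      fderiv ℂ (chartAt C2 ((chartAt C2 x).symm y) ∘ (chartAt C2 x).symm) y v := fun v => by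
    rw [show D = _ from dChartInv_eq_fderiv x hy, hd.fderiv_restrictScalars ℝ]
    rfl
  have h : D (Complex.I • u) = Complex.I • D u := by rw [key, key, map_smul]
  exact h

lemma dChartInv_injective (x : M) {y : C2} (hy : y ∈ (chartAt C2 x).target) :
    Function.Injective (dChartInv x y) := by
  have h := (mdifferentiable_chart (I := 𝓘(ℝ, C2)) x).comp_symm_deriv hy
  exact Function.LeftInverse.injective (g := mfderiv 𝓘(ℝ, C2) 𝓘(ℝ, C2) (chartAt C2 x) _)
    fun u => congrArg (fun L => L u) h

/-- The preferred chart at `x` has the identity as derivative at `x`, because it is the chart that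
identifies the tangent space with `ℂ²`. -/
lemma dChartInv_self (x : M) (u : C2) :
    (dChartInv x (chartAt C2 x x) u : C2) = u := by
  have hy := mem_chart_target C2 x
  have h1 : (dChartInv x (chartAt C2 x x) : C2 →L[ℝ] C2) = ContinuousLinearMap.id ℝ C2 := by
    rw [dChartInv_eq_fderiv x hy, (chartAt C2 x).left_inv (mem_chart_source C2 x)]
    rw [← fderiv_id (𝕜 := ℝ) (x := chartAt C2 x x)]
    refine Filter.EventuallyEq.fderiv_eq ?_
    filter_upwards [(chartAt C2 x).open_target.mem_nhds hy] with z hz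
    exact (chartAt C2 x).right_inv hz
  exact congrArg (fun L : C2 →L[ℝ] C2 => L u) h1

lemma contMDiffOn_dChartInv (x : M) (u : C2) :
    ContMDiffOn 𝓘(ℝ, C2) 𝓘(ℝ, C2).tangent ∞
      (fun y => (⟨(chartAt C2 x).symm y, dChartInv x y u⟩ : TangentBundle 𝓘(ℝ, C2) M))
      (chartAt C2 x).target := by
  have ho := (chartAt C2 x).open_target
  have h1 : ContMDiffOn 𝓘(ℝ, C2) 𝓘(ℝ, C2) ∞ (chartAt C2 x).symm (chartAt C2 x).target :=
    contMDiffOn_chart_symm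
  have h2 := h1.contMDiffOn_tangentMapWithin (m := ∞) (by simp) ho.uniqueMDiffOn
  have h3 : ContMDiffOn 𝓘(ℝ, C2) 𝓘(ℝ, C2).tangent ∞
      (fun y => (⟨y, u⟩ : TangentBundle 𝓘(ℝ, C2) C2)) (chartAt C2 x).target :=
    contMDiffOn_vectorSpace_iff_contDiffOn.2 contDiffOn_const
  refine (h2.comp h3 fun y hy => hy).congr fun y hy => ?_
  simp only [Function.comp_apply, tangentMapWithin, dChartInv, mfderivWithin_of_isOpen ho hy]
  rfl

variable [RiemannianBundle (fun x : M => TangentSpace 𝓘(ℝ, C2) x)]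

omit [IsManifold 𝓘(ℂ, C2) ω M] in
lemma localMetric_apply (x : M) (y u v : C2) :
    localMetric x y u v = inner ℝ (dChartInv x y u) (dChartInv x y v) := rfl

/-- The local expression of the metric at the base point of the chart is the inner product. The
point `x` and its image under the chart and its inverse are only propositionally equal, so the
inner product is transported along that equality. -/
lemma localMetric_self (x : M) (u v : C2) :
    localMetric x (chartAt C2 x x) u v = @inner ℝ (TS x) _ u v := by
  have h : ∀ p : M, p = x → ∀ a b : C2, @inner ℝ (TS p) _ a b = @inner ℝ (TS x) _ a b := by
    rintro _ rfl a b
    rfl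
  rw [localMetric_apply]
  refine (h _ ((chartAt C2 x).left_inv (mem_chart_source C2 x)) _ _).trans ?_
  rw [dChartInv_self, dChartInv_self]

variable [IsContMDiffRiemannianBundle 𝓘(ℝ, C2) ∞ C2 (fun x : M => TangentSpace 𝓘(ℝ, C2) x)]

lemma isMetricOn_localMetric (x : M) : IsMetricOn (localMetric x) (chartAt C2 x).target where
  isOpen := (chartAt C2 x).open_target
  contDiffOn := by
    refine contDiffOn_clm_apply.2 fun u => contDiffOn_clm_apply.2 fun v => ?_
    rw [← contMDiffOn_iff_contDiffOn]
    intro y hy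
    exact ContMDiffWithinAt.inner_bundle (contMDiffOn_dChartInv x u y hy)
      (contMDiffOn_dChartInv x v y hy)
  symm y _ u v := by simp only [localMetric_apply, real_inner_comm]
  -- the forms are positive definite, since the derivative of the chart is injective
  isInvertible y hy := by
    have hinj : Function.Injective (localMetric x y).toLinearMap := by
      rw [← LinearMap.ker_eq_bot, LinearMap.ker_eq_bot']
      intro u hu
      have h : localMetric x y u u = 0 := congrArg (fun L : C2 →L[ℝ] ℝ => L u) hu
      rw [localMetric_apply, inner_self_eq_zero] at h
      exact dChartInv_injective x hy (h.trans (map_zero _).symm)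
    have hdim : finrank ℝ C2 = finrank ℝ (C2 →L[ℝ] ℝ) := by
      rw [← (LinearMap.toContinuousLinearMap (𝕜 := ℝ) (E := C2) (F' := ℝ)).finrank_eq]
      exact Subspace.dual_finrank_eq.symm
    exact ⟨(LinearEquiv.ofInjectiveOfFinrankEq _ hinj hdim).toContinuousLinearEquiv, by ext; rfl⟩

/-- Multiplication by `i` on the model space. -/
noncomputable def modelJ : C2 →L[ℝ] C2 :=
  (Complex.I • ContinuousLinearMap.id ℂ C2).restrictScalars ℝ

lemma modelJ_apply (u : C2) : modelJ u = Complex.I • u := rfl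

lemma isKaehlerOn_localMetric (hM : IsKaehler M) (x : M) :
    IsKaehlerOn modelJ (localMetric x) (chartAt C2 x).target where
  toIsMetricOn := isMetricOn_localMetric x
  map_map u := by rw [modelJ_apply, modelJ_apply, smul_smul, Complex.I_mul_I, neg_one_smul]
  hermitian y hy u v := by
    simp only [localMetric_apply, modelJ_apply, dChartInv_smul_I x hy, hM.hermitian]
  closed y hy u v w := by
    rw [← hM.closed x y hy u v w]
    have h : (fun z => (localMetric x z).comp modelJ) =ᶠ[nhds y] localKaehlerForm x := by
      filter_upwards [(chartAt C2 x).open_target.mem_nhds hy] with z hz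
      ext a b
      change localMetric x z (modelJ a) b = inner ℝ (J _ (dChartInv x z a)) (dChartInv x z b)
      rw [localMetric_apply, modelJ_apply, dChartInv_smul_I x hz]
    simp only [dTwoForm, h.fderiv_eq]

omit [IsManifold 𝓘(ℂ, C2) ω M]
  [IsContMDiffRiemannianBundle 𝓘(ℝ, C2) ∞ C2 (fun x : M => TangentSpace 𝓘(ℝ, C2) x)] in
lemma isOrthogonalComplexStructure_J (hM : IsKaehler M) (x : M) :
    IsOrthogonalComplexStructure (J x) where
  map_map u := by
    change (Complex.I • Complex.I • (show C2 from u) : C2) = -(show C2 from u)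
    rw [smul_smul, Complex.I_mul_I, neg_one_smul]
  inner_map_map := hM.hermitian x

omit [IsManifold 𝓘(ℂ, C2) ω M]
  [IsContMDiffRiemannianBundle 𝓘(ℝ, C2) ∞ C2 (fun x : M => TangentSpace 𝓘(ℝ, C2) x)] in
lemma exists_isAdapted (hM : IsKaehler M) (x : M) :
    ∃ b : OrthonormalBasis (Fin 4) ℝ (TS x), IsAdapted (J x) (orient x) b := by
  obtain ⟨b, h0, h2⟩ := exists_orthonormalBasis_map (V := TS x) finrank_C2
    (isOrthogonalComplexStructure_J hM x)
  refine ⟨b, h0, h2, orientation_eq_realBasis_orientation b.toBasis ?_ ?_⟩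
  · exact (congrFun b.coe_toBasis 1).trans
      (h0.symm.trans (congrArg (J x) (congrFun b.coe_toBasis 0).symm))
  · exact (congrFun b.coe_toBasis 3).trans
      (h2.symm.trans (congrArg (J x) (congrFun b.coe_toBasis 2).symm))

omit [IsManifold 𝓘(ℂ, C2) ω M]
  [IsContMDiffRiemannianBundle 𝓘(ℝ, C2) ∞ C2 (fun x : M => TangentSpace 𝓘(ℝ, C2) x)] in
lemma riemann_apply (x : M) (X Y Z W : TS x) :
    riemann x X Y Z W = inner ℝ Z (curvature x X Y W) := rfl

/-- The identity map from the tangent space, normed by the metric, to the model space. The two norms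
are different, so this is a change of coordinates, although it is the identity on vectors. -/
noncomputable def tangentEquiv (x : M) : TS x ≃L[ℝ] C2 :=
  LinearEquiv.toContinuousLinearEquiv
    { toFun := fun u => u
      invFun := fun u => u
      map_add' := fun _ _ => rfl
      map_smul' := fun _ _ => rfl
      left_inv := fun _ => rfl
      right_inv := fun _ => rfl }

/-- The metric in the preferred chart, as a field of bilinear forms on the tangent space. -/
noncomputable def tangentMetric (x : M) (y : TS x) : TS x →L[ℝ] TS x →L[ℝ] ℝ :=
  (localMetric x (tangentEquiv x y)).bilinearComp
    (tangentEquiv x : TS x →L[ℝ] C2) (tangentEquiv x : TS x →L[ℝ] C2)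

omit [IsManifold 𝓘(ℂ, C2) ω M]
  [IsContMDiffRiemannianBundle 𝓘(ℝ, C2) ∞ C2 (fun x : M => TangentSpace 𝓘(ℝ, C2) x)] in
/-- The curvature, an endomorphism-valued form on the normed space `TS x`, is that of the metric
transported from the model space to `TS x`. -/
lemma curvature_eq_tangentMetric (x : M) :
    curvature x = localCurvature (tangentMetric x) ((tangentEquiv x).symm (chartAt C2 x x)) := rfl

omit [IsContMDiffRiemannianBundle 𝓘(ℝ, C2) ∞ C2 (fun x : M => TangentSpace 𝓘(ℝ, C2) x)] in
lemma tangentMetric_self (x : M) (u v : TS x) :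
    tangentMetric x ((tangentEquiv x).symm (chartAt C2 x x)) u v = inner ℝ u v := by
  change localMetric x (tangentEquiv x ((tangentEquiv x).symm (chartAt C2 x x)))
    (tangentEquiv x u) (tangentEquiv x v) = _
  rw [ContinuousLinearEquiv.apply_symm_apply]
  exact localMetric_self x _ _

/-- The curvature tensor of a Kähler surface has the symmetries of a Kähler curvature tensor. -/
theorem isKaehlerTensor_riemann (hM : IsKaehler M) (x : M) :
    IsKaehlerTensor (J x) (riemann x) := by
  have hg := (isKaehlerOn_localMetric hM x).pullback (tangentEquiv x)
  change IsKaehlerOn _ (tangentMetric x) _ at hg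
  have hy : (tangentEquiv x).symm (chartAt C2 x x) ∈
      tangentEquiv x ⁻¹' (chartAt C2 x).target := by
    rw [Set.mem_preimage, ContinuousLinearEquiv.apply_symm_apply]
    exact mem_chart_target C2 x
  have hR : ∀ X Y Z W : TS x, riemann x X Y Z W =
      tangentMetric x ((tangentEquiv x).symm (chartAt C2 x x)) Z
        (localCurvature (tangentMetric x) ((tangentEquiv x).symm (chartAt C2 x x)) X Y W) :=
    fun X Y Z W => by
      rw [tangentMetric_self, riemann_apply, curvature_eq_tangentMetric]
  refine ⟨fun X Y Z W => ?_, fun X Y Z W => ?_, fun X Y Z W => ?_, fun X Y Z W => ?_⟩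
  · rw [hR, hR]
    exact metric_localCurvature_swap₁₂ _ X Y Z W
  · rw [hR, hR]
    exact hg.metric_localCurvature_swap₃₄ hy X Y Z W
  · rw [hR, hR, hR]
    exact hg.metric_localCurvature_bianchi hy X Y Z W
  · rw [hR, hR]
    exact hg.metric_localCurvature_J hy X Y Z W

end Manifold

end KaehlerSurface

open KaehlerSurface Bundle
theorem mainTheorem4 (M : Type*) [TopologicalSpace M] [ChartedSpace C2 M]
    [IsManifold 𝓘(ℂ, C2) ω M]
    [RiemannianBundle (fun x : M => TangentSpace 𝓘(ℝ, C2) x)]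
    [IsContMDiffRiemannianBundle 𝓘(ℝ, C2) ∞ C2 (fun x : M => TangentSpace 𝓘(ℝ, C2) x)]
    (hM : IsKaehler M) :
    (IsScalarFlat M ↔ IsAntiSelfDual M) ∧
    ∀ x : M,
      (selfDualForms ℂ (orient x) =
          (ℂ ∙ fundamentalForm ℂ (J x)) ⊔ forms20 (J x) ⊔ forms02 (J x) ∧
        iSupIndep ![ℂ ∙ fundamentalForm ℂ (J x), forms20 (J x), forms02 (J x)] ∧
        (∀ α ∈ forms20 (J x), ∀ β ∈ forms02 (J x), formInner α β = 0) ∧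
        (∀ α ∈ forms20 (J x) ⊔ forms02 (J x), formInner α (fundamentalForm ℂ (J x)) = 0)) ∧
      (curvaturePlus ℂ x (fundamentalForm ℂ (J x)) =
          ((scalarCurvature x / 4 : ℝ) : ℂ) • fundamentalForm ℂ (J x) ∧
        ∀ α ∈ forms20 (J x) ⊔ forms02 (J x), curvaturePlus ℂ x α = 0) ∧
      (weylPlus ℂ x (fundamentalForm ℂ (J x)) =
          ((scalarCurvature x / 6 : ℝ) : ℂ) • fundamentalForm ℂ (J x) ∧
        ∀ α ∈ forms20 (J x) ⊔ forms02 (J x),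
          weylPlus ℂ x α = ((-scalarCurvature x / 12 : ℝ) : ℂ) • α) ∧
      operatorNormSq (weylPlus ℝ x) = scalarCurvature x ^ 2 / 24 := by
  refine ⟨forall_congr' fun x => ?_, fun x => ?_⟩
  · obtain ⟨b, hb⟩ := exists_isAdapted hM x
    exact (plusBlock_weyl_eq_zero_iff (isOrthogonalComplexStructure_J hM x) hb
      (isKaehlerTensor_riemann hM x)).symm
  · obtain ⟨b, hb⟩ := exists_isAdapted hM x
    have hJ := isOrthogonalComplexStructure_J hM x
    have hT := isKaehlerTensor_riemann hM x
    refine ⟨⟨selfDualForms_eq_sup hJ hb, iSupIndep_formsOfWeight hJ,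
      fun α hα β hβ => formInner_forms20_forms02 hJ hb hα hβ, fun α hα => ?_⟩,
      ⟨plusBlock_fundamentalForm hJ hb hT, fun α hα => ?_⟩,
      ⟨plusBlock_weyl_fundamentalForm hJ hb hT, fun α hα => ?_⟩,
      operatorNormSq_plusBlock_weyl hJ hb hT⟩
    all_goals obtain ⟨h, h'⟩ := antiInvariant_of_mem_forms20_sup_forms02 hα
    · exact formInner_antiInvariant_fundamentalForm hJ hb h h'
    · exact plusBlock_antiInvariant hJ hb hT h h'
    · rw [weylPlus, plusBlock_weyl_antiInvariant hJ hb hT h h', Complex.coe_algebraMap,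
        scalarCurvature]
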